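/- Let $n\ge 0$ be an integer and $q\in\mathbb C$ with $0<|q|<1$. Let $W_n=\mathbb Z_2^n\rtimes\mathfrak S_n$ act on Laurent polynomials in $x=(x_1,\dots,x_n)$ over $\mathbb C$ by permuting and inverting the variables. For a partition $\lambda=(\lambda_1\ge\cdots\ge\lambda_n\ge 0)$ let $m_\lambda=\sum_{\mu\in W_n\cdot\lambda}x^\mu$ (orbit sum), and write $\mu<\lambda$ if $\mu\neq\lambda$ and $\mu_1+\cdots+\mu_i\le\lambda_1+\cdots+\lambda_i$ for all $i$. For parameters $a,b,c,d,q,t$ put $\alpha=(abcd/q)^{1/2}$ and $$\mathcal D_x=\sum_{i=1}^n\sum_{\epsilon=\pm1}\frac{(1-ax_i^{\epsilon})(1-bx_i^{\epsilon})(1-cx_i^{\epsilon})(1-dx_i^{\epsilon})}{\alpha t^{n-1}(1-x_i^{2\epsilon})(1-qx_i^{2\epsilon})}\prod_{j\ne i}\frac{(1-tx_i^{\epsilon}x_j)(1-tx_i^{\epsilon}/x_j)}{(1-x_i^{\epsilon}x_j)(1-x_i^{\epsilon}/x_j)}\,(T_{q,x_i}^{\epsilon}-1),$$ where $T_{q,x_i}^{\pm1}$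 replaces $x_i$ by $q^{\pm1}x_i$. The Koornwinder polynomial $P_\lambda(x|a,b,c,d|q,t)$ is the $W_n$-invariant Laurent polynomial characterized by (a) $P_\lambda\in m_\lambda+\operatorname{span}_{\mathbb C}\{m_\mu:\mu<\lambda\}$ and (b) $\mathcal D_xP_\lambda=d_\lambda P_\lambda$, where $d_\lambda=\sum_{j=1}^n\big(\alpha t^{n-j}q^{\lambda_j}+\alpha^{-1}t^{j-n}q^{-\lambda_j}-\alpha t^{n-j}-\alpha^{-1}t^{j-n}\big)$. The Macdonald polynomial of type $(B_n,B_n)$ is $P^{(B_n,B_n)}_\lambda(x|a;q,t)=P_\lambda(x|q^{1/2},-q^{1/2},-1,a|q,t)$. The Schur polynomial of type $B_n$ is given by Weyl's character formula $$s^{B_n}_\lambda(x)=\frac{\det\big(x_i^{\lambda_j+n-j+1/2}-x_i^{-(\lambda_j+n-j+1/2)}\big)_{i,j=1}^n}{\det\big(x_i^{n-j+1/2}-x_i^{-(n-j+1/2)}\big)_{i,j=1}^n}.$$ Define $E_r(x)$ by $\prod_{i=1}^n(1-yx_i)(1-y/x_i)=\sum_{r\ge0}(-1)^rE_r(x)y^r$,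 and $E_{-1}(x)=0$. (1) When $a=t=q$, the Macdonald polynomials of type $(B_n,B_n)$ become the Schur polynomials of type $B_n$: for every partition $\lambda$ of length $n$, $s^{B_n}_\lambda$ is a $W_n$-invariant Laurent polynomial satisfying (a) and (b) for the parameters of $P^{(B_n,B_n)}_\lambda(x|q;q,q)$; and if $d_\mu\ne d_\lambda$ for all partitions $\mu<\lambda$, it is the only one, so that $s^{B_n}_\lambda=P^{(B_n,B_n)}_\lambda(x|q;q,q)$. (2) For $0\le r\le n$ and $(1^r)=(1,\dots,1,0,\dots,0)$, there is exactly one $W_n$-invariant Laurent polynomial $P^{(B_n,B_n)}_{(1^r)}(x|q;q,q)$ satisfying (a) and (b), and $$s^{B_n}_{(1^r)}(x)=P^{(B_n,B_n)}_{(1^r)}(x|q;q,q)=E_r(x)+E_{r-1}(x)=\sum_{j=0}^{\lfloor r/2\rfloor}\binom{n-r+2j}{j}m_{(1^{r-2j})}(x)+\sum_{j=0}^{\lfloor (r-1)/2\rfloor}\binom{n-r+2j+1}{j}m_{(1^{r-2j-1})}(x).$$ -/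

import Mathlib

noncomputable section

/-- Laurent polynomials in `x_1, ..., x_n` over `ℂ`: the group algebra of `ℤ^n`. -/
abbrev LaurentPoly (n : ℕ) : Type := AddMonoidAlgebra ℂ (Fin n → ℤ)

/-- Rational functions in `x_1, ..., x_n` over `ℂ`. -/
abbrev RatFun (n : ℕ) : Type := FractionRing (LaurentPoly n)

/-- The monomial `x^μ = ∏ x_i ^ μ_i`. -/
def monom {n : ℕ} (μ : Fin n → ℤ) : LaurentPoly n := AddMonoidAlgebra.single μ 1

/-- The action of the signed permutation `(ε, σ)` on exponents; these are all the elements of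
the hyperoctahedral group `W_n = ℤ_2^n ⋊ S_n`. -/
def signedPerm {n : ℕ} (w : (Fin n → ℤˣ) × Equiv.Perm (Fin n)) (μ : Fin n → ℤ) : Fin n → ℤ :=
  fun i => (w.1 i : ℤ) * μ (w.2 i)

/-- Invariance of a Laurent polynomial under the hyperoctahedral group. -/
def IsWInvariant {n : ℕ} (f : LaurentPoly n) : Prop :=
  ∀ (w : (Fin n → ℤˣ) × Equiv.Perm (Fin n)) (μ : Fin n → ℤ),
    f.coeff (signedPerm w μ) = f.coeff μ

/-- The orbit of a partition under the hyperoctahedral group. -/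
def orbitW {n : ℕ} (lam : Fin n → ℕ) : Finset (Fin n → ℤ) :=
  Finset.univ.image fun w : (Fin n → ℤˣ) × Equiv.Perm (Fin n) =>
    signedPerm w fun i => (lam i : ℤ)

/-- The monomial symmetric polynomial `m_λ`: the sum of `x^μ` over the orbit of `λ`. -/
def monomialSymm {n : ℕ} (lam : Fin n → ℕ) : LaurentPoly n := ∑ μ ∈ orbitW lam, monom μ

/-- Partitions of length `n`: `λ_1 ≥ ... ≥ λ_n ≥ 0`. -/
def IsPartition {n : ℕ} (lam : Fin n → ℕ) : Prop := Antitone lam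

/-- The strict dominance ordering: `μ ≠ λ` and `μ_1 + ... + μ_i ≤ λ_1 + ... + λ_i` for all `i`. -/
def DomLT {n : ℕ} (mu lam : Fin n → ℕ) : Prop :=
  mu ≠ lam ∧ ∀ i : Fin n, ∑ j ∈ Finset.Iic i, mu j ≤ ∑ j ∈ Finset.Iic i, lam j

/-- The one-column diagram `(1^r)`, for `r ≤ n`. -/
def column (n r : ℕ) : Fin n → ℕ := fun i => if (i : ℕ) < r then 1 else 0

/-- The variable `x_i` as a rational function. -/
def xVar {n : ℕ} (i : Fin n) : RatFun n := algebraMap (LaurentPoly n) (RatFun n) (monom (Pi.single i 1))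

/-- A complex number as a constant rational function. -/
def constRat (n : ℕ) (z : ℂ) : RatFun n := algebraMap ℂ (RatFun n) z

/-- The shift `f(x_1, ..., x_i, ..., x_n) ↦ f(x_1, ..., z x_i, ..., x_n)`, for `z ≠ 0`. -/
def shiftVar {n : ℕ} (i : Fin n) (z : ℂ) (f : LaurentPoly n) : LaurentPoly n :=
  ∑ μ ∈ f.coeff.support, AddMonoidAlgebra.single μ (z ^ μ i * f.coeff μ)

/-- `α = (abcd/q)^{1/2}`. (Replacing `α` by `-α` changes the sign of the `q`-difference operator
and of its eigenvalues simultaneously, so the choice of the root is immaterial.) -/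
def koornwinderAlpha (a b c d q : ℂ) : ℂ := (a * b * c * d / q) ^ (1 / 2 : ℂ)

/-- The coefficient, evaluated at `y = x_i` or `y = 1/x_i`, of the shift of the `i`-th variable in
Koornwinder's operator. -/
def koornwinderCoeff {n : ℕ} (a b c d q t : ℂ) (i : Fin n) (y : RatFun n) : RatFun n :=
  ((1 - constRat n a * y) * (1 - constRat n b * y) * (1 - constRat n c * y) * (1 - constRat n d * y)) /
      (constRat n (koornwinderAlpha a b c d q * t ^ (n - 1)) * (1 - y ^ 2) * (1 - constRat n q * y ^ 2)) *
    ∏ j ∈ Finset.univ.erase i,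
      ((1 - constRat n t * y * xVar j) * (1 - constRat n t * (y / xVar j))) / ((1 - y * xVar j) * (1 - y / xVar j))

/-- Koornwinder's `q`-difference operator `D_x(a, b, c, d | q, t)`, on Laurent polynomials. -/
def koornwinderOp {n : ℕ} (a b c d q t : ℂ) (f : LaurentPoly n) : RatFun n :=
  ∑ i : Fin n,
    (koornwinderCoeff a b c d q t i (xVar i) *
        algebraMap (LaurentPoly n) (RatFun n) (shiftVar i q f - f) +
      koornwinderCoeff a b c d q t i (xVar i)⁻¹ *
        algebraMap (LaurentPoly n) (RatFun n) (shiftVar i q⁻¹ f - f))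

/-- `⟨x; y⟩ = x + x⁻¹ - y - y⁻¹`. -/
def angleBracket (x y : ℂ) : ℂ := x + x⁻¹ - y - y⁻¹

/-- The eigenvalue `d_λ = ∑_j ⟨α t^{n-j} q^{λ_j}; α t^{n-j}⟩` (here `j` runs from `0`). -/
def koornwinderEigenvalue {n : ℕ} (a b c d q t : ℂ) (lam : Fin n → ℕ) : ℂ :=
  ∑ j : Fin n, angleBracket (koornwinderAlpha a b c d q * t ^ (n - 1 - (j : ℕ)) * q ^ lam j)
    (koornwinderAlpha a b c d q * t ^ (n - 1 - (j : ℕ)))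

/-- The conditions which characterize the Koornwinder polynomial `P_λ(x | a, b, c, d | q, t)`. -/
structure IsKoornwinder {n : ℕ} (a b c d q t : ℂ) (lam : Fin n → ℕ) (P : LaurentPoly n) :
    Prop where
  invariant : IsWInvariant P
  triangular : P - monomialSymm lam ∈
    Submodule.span ℂ {f | ∃ mu : Fin n → ℕ, IsPartition mu ∧ DomLT mu lam ∧ f = monomialSymm mu}
  eigen : koornwinderOp a b c d q t P =
    constRat n (koornwinderEigenvalue a b c d q t lam) * algebraMap (LaurentPoly n) (RatFun n) P

open Classical in
/-- The Koornwinder polynomial `P_λ(x | a, b, c, d | q, t)`, as the Laurent polynomial with the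
characterizing properties (meaningful where there is exactly one). -/
def koornwinderP {n : ℕ} (a b c d q t : ℂ) (lam : Fin n → ℕ) : LaurentPoly n :=
  if h : ∃ P, IsKoornwinder a b c d q t lam P then h.choose else 0

/-- The characterizing conditions of the Macdonald polynomial of type `(B_n, B_n)`, that is,
of the Koornwinder polynomial with parameters `(q^{1/2}, -q^{1/2}, -1, a | q, t)`. -/
def IsMacdonaldBB {n : ℕ} (a q t : ℂ) (lam : Fin n → ℕ) (P : LaurentPoly n) : Prop :=
  IsKoornwinder (q ^ (1 / 2 : ℂ)) (-q ^ (1 / 2 : ℂ)) (-1) a q t lam P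

/-- The Macdonald polynomial of type `(B_n, B_n)`:
`P^{(B_n,B_n)}_λ(x | a; q, t) = P_λ(x | q^{1/2}, -q^{1/2}, -1, a | q, t)`. -/
def macdonaldBB {n : ℕ} (a q t : ℂ) (lam : Fin n → ℕ) : LaurentPoly n :=
  koornwinderP (q ^ (1 / 2 : ℂ)) (-q ^ (1 / 2 : ℂ)) (-1) a q t lam

/-- The eigenvalue `d_λ` for the Macdonald polynomial of type `(B_n, B_n)`. -/
def macdonaldBBEigenvalue {n : ℕ} (a q t : ℂ) (lam : Fin n → ℕ) : ℂ :=
  koornwinderEigenvalue (q ^ (1 / 2 : ℂ)) (-q ^ (1 / 2 : ℂ)) (-1) a q t lam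

/-- The determinant `det (x_i^{l_j + 1/2} - x_i^{-(l_j + 1/2)})` with `l_j = λ_j + n - j`,
multiplied by `∏ x_i^{1/2}` to clear the half-integral exponents (here `j` runs from `0`). -/
def alternantB {n : ℕ} (lam : Fin n → ℕ) : RatFun n :=
  Matrix.det (Matrix.of fun i j : Fin n =>
    xVar i ^ (lam j + (n - 1 - (j : ℕ)) + 1) - (xVar i)⁻¹ ^ (lam j + (n - 1 - (j : ℕ))))

/-- The Schur polynomial `s_λ^{B_n}` of type `B_n`: the irreducible character of `SO(2n+1)` with
highest weight `λ`, by Weyl's formula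
`det (x_i^{λ_j + n - j + 1/2} - x_i^{-(λ_j + n - j + 1/2)}) /
  det (x_i^{n - j + 1/2} - x_i^{-(n - j + 1/2)})`. -/
def schurB {n : ℕ} (lam : Fin n → ℕ) : RatFun n := alternantB lam / alternantB (fun _ => 0)

/-- The generating function `E(x | y) = ∏ (1 - y x_i)(1 - y / x_i)`, a polynomial in `y`. -/
def genE (n : ℕ) : Polynomial (LaurentPoly n) :=
  ∏ i : Fin n, (1 - Polynomial.X * Polynomial.C (monom (Pi.single i 1))) *
    (1 - Polynomial.X * Polynomial.C (monom (Pi.single i (-1))))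

/-- `E_r(x)`, where `E(x | y) = ∑_{r ≥ 0} (-1)^r E_r(x) y^r`, and `E_r(x) = 0` for `r < 0`. -/
def polyE (n : ℕ) (r : ℤ) : LaurentPoly n :=
  if 0 ≤ r then (-1) ^ r.toNat * (genE n).coeff r.toNat else 0

end

/-! Write Δ for `weylNum fun _ => 0` and N_λ for `weylNum lam`: the Weyl denominator and numerator
of type B, both multiplied by ∏ x_i^{1/2}, so that s_λ = N_λ/Δ. Put s = q^{1/2}. At a = t = q the
coefficient of T_{q,x_i}^e in Koornwinder's operator D is s^{-e} T_{q,x_i}^e(Δ)/Δ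
(`koornwinderCoeff_mul_weylNum`). Hence Δ·Df = L(Δf) − L(Δ)f with L = ∑ (s⁻¹T_{q,x_i} + s
T_{q,x_i}⁻¹) (`weylNum_mul_koornwinderOp`). L is diagonal on monomials, and its eigenvalue is
constant on orbits of signed permutations centred at (1/2, …, 1/2). N_λ is an alternating sum over
such an orbit, hence an eigenvector of L, and s_λ satisfies (b).

For (a), Δ·m_λ is a sum over μ in the orbit of λ of alternating sums at ρ + μ. Each is zero or ±N_ν
with ν ≤ λ, and N_λ itself occurs only for μ = λ (`anti_leadExp_add`). Inverting this unitriangular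
relation by induction on dominance shows that Δ divides N_λ with a quotient in m_λ + lower terms
(`exists_weylNum_mul_eq`).

For uniqueness, Δ times the difference of two solutions lies in the span of the N_μ with μ < λ and
is an L-eigenvector for the eigenvalue of λ; if no lower eigenvalue equals it, it vanishes
(`eq_zero_of_mem_lowerSpan`). Below a column there are only shorter columns, whose eigenvalues
differ because 0 < |q| < 1 (`macdonaldBBEigenvalue_column_ne`).

The formula with E_r comes from the Weyl denominator in the n + 1 variables y, x_1, …, x_n: the
product formula gives E(x|y), and expansion along the row of y gives the N_{(1^r)} as minors
(`genE_mul_weylNum`). Expanding ∏ (1 − y(x_i + x_i⁻¹) + y²) yields the monomial sums. -/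

/-! ### Determinants of type B and the Weyl denominator -/

/-- The polynomials `p_k` with `(x - 1) p_k(x + x⁻¹) = x^(k+1) - x^(-k)`. -/
noncomputable def halfChebyshev (R : Type*) [CommRing R] : ℕ → Polynomial R
  | 0 => 1
  | 1 => Polynomial.X + 1
  | k + 2 => Polynomial.X * halfChebyshev R (k + 1) - halfChebyshev R k

/-- Monic polynomials of degrees 0, 1, 2, … may replace the powers in a Vandermonde determinant;
this is what makes `altDet_rho` a product. -/
theorem halfChebyshev_monic_natDegree (R : Type*) [CommRing R] [Nontrivial R] (k : ℕ) :
    (halfChebyshev R k).Monic ∧ (halfChebyshev R k).natDegree = k := by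
  induction k using Nat.twoStepInduction with
  | zero => simp [halfChebyshev]
  | one =>
    refine ⟨?_, ?_⟩
    · simpa [halfChebyshev] using Polynomial.monic_X_add_C (1 : R)
    · simpa [halfChebyshev] using Polynomial.natDegree_X_add_C (1 : R)
  | more k h0 h1 =>
    have hX : (Polynomial.X * halfChebyshev R (k + 1)).Monic := Polynomial.monic_X.mul h1.1
    have hXd : (Polynomial.X * halfChebyshev R (k + 1)).natDegree = k + 2 := by
      rw [Polynomial.monic_X.natDegree_mul h1.1, h1.2, Polynomial.natDegree_X]; ring
    have hlt : (halfChebyshev R k).degree < (Polynomial.X * halfChebyshev R (k + 1)).degree :=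
      Polynomial.degree_lt_degree (by omega)
    refine ⟨hX.sub_of_left hlt, ?_⟩
    rw [halfChebyshev, Polynomial.natDegree_sub_eq_left_of_natDegree_lt (by omega), hXd]

theorem sub_one_mul_eval_halfChebyshev {R : Type*} [CommRing R] {x x' : R} (h : x * x' = 1)
    (k : ℕ) : (x - 1) * (halfChebyshev R k).eval (x + x') = x ^ (k + 1) - x' ^ k := by
  induction k using Nat.twoStepInduction with
  | zero => simp [halfChebyshev]
  | one => simp [halfChebyshev]; linear_combination h
  | more k h0 h1 =>
    simp only [halfChebyshev, Polynomial.eval_sub, Polynomial.eval_mul, Polynomial.eval_X]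
    linear_combination (x + x') * h1 - h0 + (x ^ (k + 1) - x' ^ k) * h

/-- The determinant `det (x_i^(l_j + 1) - x_i^(-l_j))`, where `x'` plays the role of `x⁻¹`. -/
def altDet {R : Type*} [CommRing R] {n : ℕ} (x x' : Fin n → R) (l : Fin n → ℕ) : R :=
  Matrix.det (Matrix.of fun i j : Fin n => x i ^ (l j + 1) - x' i ^ l j)

theorem altDet_map {R S : Type*} [CommRing R] [CommRing S] (f : R →+* S) {n : ℕ}
    (x x' : Fin n → R) (l : Fin n → ℕ) :
    f (altDet x x' l) = altDet (fun i => f (x i)) (fun i => f (x' i)) l := by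
  rw [altDet, altDet, RingHom.map_det]
  congr 1
  ext i j
  simp

/-- The Weyl denominator formula of type `B`. -/
theorem altDet_rho {R : Type*} [CommRing R] [Nontrivial R] {n : ℕ} (x x' : Fin n → R)
    (h : ∀ i, x i * x' i = 1) :
    altDet x x' (fun j => n - 1 - (j : ℕ)) = (∏ i, (x i - 1)) *
      ∏ i : Fin n, ∏ j ∈ Finset.Ioi i, ((x i + x' i) - (x j + x' j)) := by
  set z : Fin n → R := fun i => x i + x' i with hz
  -- A factor x_i − 1 comes out of row i and leaves polynomials in z_i; the exponents decrease along
  -- a row, so the columns appear in reverse order.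
  have h1 : altDet x x' (fun j => n - 1 - (j : ℕ)) = (∏ i, (x i - 1)) *
      Matrix.det ((Matrix.of fun i j : Fin n =>
        (halfChebyshev R j).eval (z i)).submatrix id Fin.revPerm) := by
    rw [altDet, ← Matrix.det_mul_column]
    congr 1
    ext i j
    simp only [Matrix.of_apply, Matrix.submatrix_apply, id, hz, Fin.revPerm_apply, Fin.val_rev]
    rw [sub_one_mul_eval_halfChebyshev (h i)]
    congr 2 <;> omega
  have h2 := Matrix.det_eval_matrixOfPolynomials_eq_det_vandermonde z
    (fun k : Fin n => halfChebyshev R k)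
    (fun i => (halfChebyshev_monic_natDegree R i).2) (fun i => (halfChebyshev_monic_natDegree R i).1)
  have h3 : (Matrix.vandermonde z).submatrix id Fin.revPerm = Matrix.projVandermonde 1 z := by
    ext i j
    simp [Matrix.projVandermonde_apply, Matrix.vandermonde_apply]
  rw [h1, Matrix.det_permute', ← h2, ← Matrix.det_permute', h3, Matrix.det_projVandermonde]
  simp [hz]

theorem altDet_rho_ne_zero {R : Type*} [CommRing R] [IsDomain R] {n : ℕ} (x x' : Fin n → R)
    (h : ∀ i, x i * x' i = 1) (h1 : ∀ i, x i ≠ 1)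
    (h2 : ∀ i j, i ≠ j → x i + x' i ≠ x j + x' j) :
    altDet x x' (fun j => n - 1 - (j : ℕ)) ≠ 0 := by
  rw [altDet_rho x x' h]
  refine mul_ne_zero (Finset.prod_ne_zero_iff.2 fun i _ => sub_ne_zero.2 (h1 i))
    (Finset.prod_ne_zero_iff.2 fun i _ => Finset.prod_ne_zero_iff.2 fun j hj =>
      sub_ne_zero.2 (h2 i j (Finset.mem_Ioi.1 hj).ne))

/-- Expansion of the Weyl denominator in `n + 1` variables along the row of the first one. -/
theorem altDet_column_expansion {R : Type*} [CommRing R] [Nontrivial R] {n : ℕ} (x x' : Fin n → R)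
    (h : ∀ i, x i * x' i = 1) (y y' : R) (hy : y * y' = 1) :
    (y - 1) * (∏ i, ((y + y') - (x i + x' i))) * altDet x x' (fun j => n - 1 - (j : ℕ)) =
      ∑ r : Fin (n + 1), (-1) ^ (r : ℕ) * (y ^ (n - r + 1) - y' ^ (n - r)) *
        altDet x x' (fun j => column n r j + (n - 1 - (j : ℕ))) := by
  have h1 : ∀ i : Fin (n + 1), (Fin.cons y x : Fin (n + 1) → R) i *
      (Fin.cons y' x' : Fin (n + 1) → R) i = 1 := by
    intro i
    refine Fin.cases ?_ (fun i => ?_) i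
    · simpa using hy
    · simpa using h i
  have h2 := altDet_rho (Fin.cons y x : Fin (n + 1) → R) (Fin.cons y' x') h1
  have hI : Finset.Ioi (0 : Fin (n + 1)) = Finset.univ.map (Fin.succEmb n) := by
    ext j; refine Fin.cases ?_ (fun j => ?_) j <;> simp
  have hI' : ∀ i : Fin n, Finset.Ioi i.succ = (Finset.Ioi i).map (Fin.succEmb n) := by
    intro i
    ext j; refine Fin.cases ?_ (fun j => ?_) j <;> simp
  rw [Fin.prod_univ_succ, Fin.prod_univ_succ, hI] at h2
  simp only [Fin.cons_zero, Fin.cons_succ, hI', Finset.prod_map, Fin.coe_succEmb] at h2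
  rw [altDet_rho x x' h]
  trans altDet (Fin.cons y x : Fin (n + 1) → R) (Fin.cons y' x')
    (fun j => n + 1 - 1 - (j : ℕ))
  · rw [h2]; ring
  · rw [altDet, Matrix.det_succ_row_zero]
    refine Finset.sum_congr rfl fun r _ => ?_
    simp only [Matrix.of_apply, Fin.cons_zero, Nat.add_sub_cancel]
    congr 1
    rw [altDet]
    congr 1
    ext i j
    simp only [Matrix.submatrix_apply, Matrix.of_apply, Fin.cons_succ]
    -- Deleting the entry in position r from n, n − 1, …, 0 leaves n − 1, …, 0 with the first r
    -- entries raised by one.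
    have : n - ((r.succAbove j : Fin (n + 1)) : ℕ) = column n r j + (n - 1 - (j : ℕ)) := by
      have := j.2
      rw [column]
      split_ifs with hj
      · rw [Fin.succAbove_of_castSucc_lt _ _ (by simpa [Fin.lt_def] using hj)]
        simp; omega
      · rw [Fin.succAbove_of_le_castSucc _ _ (by simpa [Fin.le_def] using hj)]
        simp; omega
    rw [this]

theorem altDet_comp_perm {R : Type*} [CommRing R] {n : ℕ} (x x' : Fin n → R) (l : Fin n → ℕ)
    (σ : Equiv.Perm (Fin n)) :
    altDet (x ∘ σ) (x' ∘ σ) l = ((Equiv.Perm.sign σ : ℤ) : R) * altDet x x' l := by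
  rw [altDet, altDet, ← Matrix.det_permute]
  rfl

/-- The effect on the Weyl denominator of replacing one variable. -/
theorem altDet_rho_update {R : Type*} [CommRing R] [Nontrivial R] {n : ℕ} (x x' : Fin n → R)
    (h : ∀ i, x i * x' i = 1) (i : Fin n) (y y' : R) (hy : y * y' = 1) :
    altDet (Function.update x i y) (Function.update x' i y') (fun j => n - 1 - (j : ℕ)) *
        ((x i - 1) * ∏ j ∈ Finset.univ.erase i, ((x i + x' i) - (x j + x' j))) =
      (y - 1) * (∏ j ∈ Finset.univ.erase i, ((y + y') - (x j + x' j))) *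
        altDet x x' (fun j => n - 1 - (j : ℕ)) := by
  obtain _ | m := n
  · exact i.elim0
  -- The first index is isolated directly in the product over i < j; a transposition carries any
  -- other index there, and its sign affects both sides equally.
  have key : ∀ (x x' : Fin (m + 1) → R), (∀ i, x i * x' i = 1) →
      altDet (Function.update x 0 y) (Function.update x' 0 y') (fun j => m + 1 - 1 - (j : ℕ)) *
        ((x 0 - 1) * ∏ j ∈ Finset.univ.erase 0, ((x 0 + x' 0) - (x j + x' j))) =
      (y - 1) * (∏ j ∈ Finset.univ.erase 0, ((y + y') - (x j + x' j))) *
        altDet x x' (fun j => m + 1 - 1 - (j : ℕ)) := by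
    intro x x' h
    have hu : ∀ i, Function.update x 0 y i * Function.update x' 0 y' i = 1 := by
      intro i
      refine Fin.cases ?_ (fun i => ?_) i
      · simpa using hy
      · simpa using h i.succ
    have hI : Finset.univ.erase (0 : Fin (m + 1)) = Finset.univ.map (Fin.succEmb m) := by
      ext j; refine Fin.cases ?_ (fun j => ?_) j <;> simp
    have hI0 : Finset.Ioi (0 : Fin (m + 1)) = Finset.univ.map (Fin.succEmb m) := by
      ext j; refine Fin.cases ?_ (fun j => ?_) j <;> simp
    have hI' : ∀ i : Fin m, Finset.Ioi i.succ = (Finset.Ioi i).map (Fin.succEmb m) := by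
      intro i
      ext j; refine Fin.cases ?_ (fun j => ?_) j <;> simp
    rw [altDet_rho _ _ h, altDet_rho _ _ hu]
    simp only [Fin.prod_univ_succ, hI, hI0, hI', Finset.prod_map, Fin.coe_succEmb,
      Function.update_self, Function.update_of_ne (Fin.succ_ne_zero _)]
    ring
  have h0 := key (x ∘ Equiv.swap 0 i) (x' ∘ Equiv.swap 0 i) (fun j => h _)
  have hup : ∀ (f : Fin (m + 1) → R) (a : R), Function.update (f ∘ Equiv.swap 0 i) 0 a =
      Function.update f i a ∘ Equiv.swap 0 i := by
    intro f a
    rw [Function.update_comp_equiv]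
    simp
  have hpr : ∀ f : Fin (m + 1) → R, ∏ j ∈ Finset.univ.erase 0, f (Equiv.swap 0 i j) =
      ∏ j ∈ Finset.univ.erase i, f j := by
    intro f
    refine Finset.prod_bij' (fun j _ => Equiv.swap 0 i j) (fun j _ => Equiv.swap 0 i j)
      ?_ ?_ (by simp) (by simp) (by simp)
    · intro j hj
      simpa [Equiv.swap_apply_eq_iff] using hj
    · intro j hj
      simpa [Equiv.swap_apply_eq_iff] using hj
  rw [hup, hup, altDet_comp_perm, altDet_comp_perm] at h0
  simp only [Function.comp_apply, Equiv.swap_apply_left] at h0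
  rw [hpr fun j => (x i + x' i) - (x j + x' j), hpr fun j => (y + y') - (x j + x' j)] at h0
  have hs : ((Equiv.Perm.sign (Equiv.swap 0 i) : ℤ) : R) *
      ((Equiv.Perm.sign (Equiv.swap 0 i) : ℤ) : R) = 1 := by
    rw [← Int.cast_mul, ← Units.val_mul, Int.units_mul_self]; simp
  linear_combination ((Equiv.Perm.sign (Equiv.swap 0 i) : ℤ) : R) * h0 -
    (altDet (Function.update x i y) (Function.update x' i y') (fun j => m + 1 - 1 - (j : ℕ)) *
        ((x i - 1) * ∏ j ∈ Finset.univ.erase i, ((x i + x' i) - (x j + x' j))) -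
      (y - 1) * (∏ j ∈ Finset.univ.erase i, ((y + y') - (x j + x' j))) *
        altDet x x' (fun j => m + 1 - 1 - (j : ℕ))) * hs

/-! ### Laurent polynomials inside the rational functions -/

theorem monom_mul {n : ℕ} (μ ν : Fin n → ℤ) : monom μ * monom ν = monom (μ + ν) := by
  simp [monom, AddMonoidAlgebra.single_mul_single]

theorem monom_zero {n : ℕ} : monom (0 : Fin n → ℤ) = 1 := rfl

theorem monom_injective {n : ℕ} : Function.Injective (monom (n := n)) :=
  AddMonoidAlgebra.single_left_injective one_ne_zero

/-- The inclusion of Laurent polynomials into rational functions. -/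
noncomputable abbrev toRat (n : ℕ) : LaurentPoly n →+* RatFun n :=
  algebraMap (LaurentPoly n) (RatFun n)

theorem toRat_injective (n : ℕ) : Function.Injective (toRat n) :=
  IsFractionRing.injective (LaurentPoly n) (RatFun n)

/-- The variable `x_i` (for `e = 1`) or its inverse (for `e = -1`) as a Laurent polynomial. -/
noncomputable abbrev varL {n : ℕ} (e : ℤ) (i : Fin n) : LaurentPoly n := monom (Pi.single i e)

theorem varL_mul_varL {n : ℕ} (i : Fin n) : varL 1 i * varL (-1) i = 1 := by
  rw [monom_mul, ← Pi.single_add]; simp [monom_zero]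

theorem toRat_varL_one {n : ℕ} (i : Fin n) : toRat n (varL 1 i) = xVar i := rfl

theorem xVar_inv {n : ℕ} (i : Fin n) : (xVar i)⁻¹ = toRat n (varL (-1) i) := by
  refine inv_eq_of_mul_eq_one_right ?_
  rw [xVar, ← map_mul, varL_mul_varL, map_one]

theorem xVar_ne_zero {n : ℕ} (i : Fin n) : xVar i ≠ 0 := by
  intro h
  have := congrArg (toRat n) (varL_mul_varL i)
  rw [map_mul, toRat_varL_one, h] at this
  simp at this

/-- The numerator of Weyl's formula as a Laurent polynomial. -/
noncomputable def weylNum {n : ℕ} (lam : Fin n → ℕ) : LaurentPoly n :=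
  altDet (varL 1) (varL (-1)) fun j => lam j + (n - 1 - (j : ℕ))

theorem alternantB_eq {n : ℕ} (lam : Fin n → ℕ) : alternantB lam = toRat n (weylNum lam) := by
  rw [weylNum, altDet_map, alternantB, altDet]
  simp only [← xVar_inv]
  rfl

theorem weylNum_zero {n : ℕ} : weylNum (fun _ : Fin n => 0) =
    altDet (varL 1) (varL (-1)) fun j => n - 1 - (j : ℕ) := by
  simp [weylNum]

theorem single_one_ne_zero {n : ℕ} (i : Fin n) {e : ℤ} (he : e ≠ 0) : (Pi.single i e : Fin n → ℤ) ≠ 0 := by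
  simpa using he

theorem varL_add_varL_ne {n : ℕ} {i j : Fin n} (h : i ≠ j) :
    varL 1 i + varL (-1) i ≠ varL 1 j + varL (-1) j := by
  intro he
  have h1 := congrArg (fun f : LaurentPoly n => f.coeff (Pi.single i 1)) he
  have e2 : (Pi.single j (-1) : Fin n → ℤ) ≠ Pi.single i 1 := fun h' => by
    have := congrFun h' i; simp [h] at this
  have e3 : (Pi.single j 1 : Fin n → ℤ) ≠ Pi.single i 1 := fun h' => by
    have := congrFun h' i; simp [h] at this
  simp [monom, e2, e3] at h1

theorem weylNum_zero_ne_zero (n : ℕ) : weylNum (fun _ : Fin n => 0) ≠ 0 := by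
  rw [weylNum_zero]
  refine altDet_rho_ne_zero _ _ varL_mul_varL (fun i h => ?_) fun i j h => varL_add_varL_ne h
  rw [← monom_zero] at h
  have := congrFun (monom_injective h) i
  simp at this

/-! ### Koornwinder's coefficients as shifts of the Weyl denominator -/

/-- The shift of the `i`-th variable as an algebra homomorphism. -/
noncomputable def shiftHom {n : ℕ} (i : Fin n) (z : ℂˣ) : LaurentPoly n →ₐ[ℂ] LaurentPoly n :=
  AddMonoidAlgebra.lift ℂ (LaurentPoly n) (Fin n → ℤ)
    { toFun := fun μ => AddMonoidAlgebra.single μ.toAdd ((z ^ μ.toAdd i : ℂˣ) : ℂ)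
      map_one' := by simp [AddMonoidAlgebra.one_def]
      map_mul' := fun μ ν => by
        simp [AddMonoidAlgebra.single_mul_single, zpow_add] }

theorem shiftHom_monom {n : ℕ} (i : Fin n) (z : ℂˣ) (μ : Fin n → ℤ) :
    shiftHom i z (monom μ) = ((z : ℂ) ^ μ i) • monom μ := by
  simp [shiftHom, monom]

theorem shiftVar_eq {n : ℕ} (i : Fin n) (z : ℂˣ) (f : LaurentPoly n) :
    shiftVar i z f = shiftHom i z f := by
  rw [shiftVar, shiftHom, AddMonoidAlgebra.lift_apply, Finsupp.sum]
  refine Finset.sum_congr rfl fun μ _ => ?_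
  simp [mul_comm]

theorem smul_eq_constRat {n : ℕ} (z : ℂ) (f : LaurentPoly n) :
    toRat n (z • f) = constRat n z * toRat n f := by
  rw [Algebra.smul_def, map_mul, constRat, IsScalarTower.algebraMap_apply ℂ (LaurentPoly n) (RatFun n)]

theorem shiftHom_weylNum_zero {n : ℕ} (i : Fin n) (z : ℂˣ) :
    shiftHom i z (weylNum fun _ => 0) =
      altDet (Function.update (varL 1) i ((z : ℂ) • varL 1 i))
        (Function.update (varL (-1)) i ((z : ℂ)⁻¹ • varL (-1) i)) fun j => n - 1 - (j : ℕ) := by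
  rw [weylNum_zero]
  refine (altDet_map (shiftHom i z : LaurentPoly n →+* LaurentPoly n) _ _ _).trans ?_
  congr 1
  · ext1 j
    rw [RingHom.coe_coe, shiftHom_monom]
    rcases eq_or_ne i j with rfl | h
    · simp
    · simp [h, h.symm]
  · ext1 j
    rw [RingHom.coe_coe, shiftHom_monom]
    rcases eq_or_ne i j with rfl | h
    · simp
    · simp [h, h.symm]

/-- Here abcd/q = s·(−s)·(−1)·q/q = s² = q, so α is the same root of q that enters the parameters.
-/
theorem koornwinderAlpha_BB {q s : ℂ} (hq : q ≠ 0) (hs : s ^ 2 = q) :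
    koornwinderAlpha s (-s) (-1) q q = q ^ (1 / 2 : ℂ) := by
  rw [koornwinderAlpha]
  congr 1
  field_simp
  linear_combination hs

theorem constRat_ne_zero {n : ℕ} {z : ℂ} (hz : z ≠ 0) : constRat n z ≠ 0 := by
  rw [constRat]; simpa using hz

theorem constRat_mul {n : ℕ} (z w : ℂ) : constRat n (z * w) = constRat n z * constRat n w :=
  map_mul _ _ _

theorem constRat_mul_toRat_ne_one {n : ℕ} (z : ℂ) {μ : Fin n → ℤ} (hμ : μ ≠ 0) :
    constRat n z * toRat n (monom μ) ≠ 1 := by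
  rw [← smul_eq_constRat, ← map_one (toRat n)]
  intro h
  have := congrArg (fun f : LaurentPoly n => f.coeff 0) (toRat_injective n h)
  simp [monom, AddMonoidAlgebra.one_def, hμ] at this

theorem toRat_ne_one {n : ℕ} {μ : Fin n → ℤ} (hμ : μ ≠ 0) : toRat n (monom μ) ≠ 1 := by
  simpa [constRat] using constRat_mul_toRat_ne_one 1 hμ

/-- At the parameters of type `(B_n, B_n)` with `a = t = q`, Koornwinder's coefficients simplify. -/
theorem koornwinderCoeff_BB {n : ℕ} {q s : ℂ} (hq : q ≠ 0) (hs : s ^ 2 = q)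
    (hα : q ^ (1 / 2 : ℂ) = s) (i : Fin n) {e : ℤ} (he : e = 1 ∨ e = -1) :
    koornwinderCoeff s (-s) (-1) q q q i (toRat n (varL e i)) =
      (1 - constRat n q * toRat n (varL e i)) / (constRat n s * (1 - toRat n (varL e i))) *
        ∏ j ∈ Finset.univ.erase i,
          ((constRat n q * toRat n (varL e i) + (constRat n q * toRat n (varL e i))⁻¹) -
            (xVar j + (xVar j)⁻¹)) / ((xVar i + (xVar i)⁻¹) - (xVar j + (xVar j)⁻¹)) := by
  have he0 : e ≠ 0 := by rcases he with rfl | rfl <;> norm_num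
  set y := toRat n (varL e i) with hy
  have hyz : xVar i + (xVar i)⁻¹ = y + y⁻¹ := by
    rcases he with rfl | rfl
    · rw [hy, toRat_varL_one]
    · rw [hy, ← xVar_inv, inv_inv, add_comm]
  have hy0 : y ≠ 0 := by
    rcases he with rfl | rfl
    · exact xVar_ne_zero i
    · rw [hy, ← xVar_inv]; exact inv_ne_zero (xVar_ne_zero i)
  have hs0 : s ≠ 0 := by rintro rfl; simp at hs; exact hq hs.symm
  have hq' : constRat n q ≠ 0 := constRat_ne_zero hq
  have hs' : constRat n s ≠ 0 := constRat_ne_zero hs0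
  have hy2 : y ^ 2 = toRat n (monom (Pi.single i e + Pi.single i e)) := by
    rw [← monom_mul, map_mul, pow_two]
  have hne : (Pi.single i e + Pi.single i e : Fin n → ℤ) ≠ 0 := by
    rw [← Pi.single_add]; exact single_one_ne_zero i (by omega)
  have h1 : 1 - y ^ 2 ≠ 0 := by
    rw [hy2, sub_ne_zero]; exact (toRat_ne_one hne).symm
  have h2 : 1 - constRat n q * y ^ 2 ≠ 0 := by
    rw [hy2, sub_ne_zero]; exact (constRat_mul_toRat_ne_one q hne).symm
  have h3 : 1 - y ≠ 0 := by
    rw [sub_ne_zero]; exact (toRat_ne_one (single_one_ne_zero i he0)).symm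
  have hc : constRat n q = constRat n s ^ 2 := by rw [← hs]; simp [constRat]
  have hm : constRat n (-s) = - constRat n s := by simp [constRat]
  have hm1 : constRat n (-1) = -1 := by simp [constRat]
  have hp : constRat n (s * q ^ (n - 1)) =
      constRat n s * ∏ j ∈ Finset.univ.erase i, constRat n q := by
    simp [constRat, Finset.card_erase_of_mem]
  rw [koornwinderCoeff, koornwinderAlpha_BB hq hs, hα, hp]
  -- Each factor is q times a ratio of differences of values of z + z⁻¹; these n − 1 factors q
  -- cancel t^{n-1} in the denominator.
  have hfac : ∀ j ∈ Finset.univ.erase i,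
      ((1 - constRat n q * y * xVar j) * (1 - constRat n q * (y / xVar j))) /
        ((1 - y * xVar j) * (1 - y / xVar j)) =
      constRat n q * (((constRat n q * y + (constRat n q * y)⁻¹) - (xVar j + (xVar j)⁻¹)) /
        ((xVar i + (xVar i)⁻¹) - (xVar j + (xVar j)⁻¹))) := by
    intro j hj
    have hxj := xVar_ne_zero j
    have e1 : (1 - constRat n q * y * xVar j) * (1 - constRat n q * (y / xVar j)) =
        y * (constRat n q * ((constRat n q * y + (constRat n q * y)⁻¹) - (xVar j + (xVar j)⁻¹))) := by
      field_simp; ring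
    have e2 : (1 - y * xVar j) * (1 - y / xVar j) =
        y * ((xVar i + (xVar i)⁻¹) - (xVar j + (xVar j)⁻¹)) := by
      rw [hyz]; field_simp; ring
    rw [e1, e2, mul_div_mul_left _ _ hy0, mul_div_assoc]
  rw [Finset.prod_congr rfl hfac, Finset.prod_mul_distrib, hm, hm1]
  have hP : ∏ j ∈ Finset.univ.erase i, constRat n q ≠ 0 :=
    Finset.prod_ne_zero_iff.2 fun _ _ => hq'
  generalize ∏ j ∈ Finset.univ.erase i, constRat n q = p at *
  generalize ∏ j ∈ Finset.univ.erase i, (_ / _ : RatFun n) = r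
  -- The parameters ±q^{1/2} cancel 1 − qy², and −1 supplies the factor 1 + y of 1 − y².
  have e3 : (1 - constRat n s * y) * (1 - -constRat n s * y) * (1 - -1 * y) *
      (1 - constRat n q * y) = (1 - constRat n q * y ^ 2) * (1 + y) * (1 - constRat n q * y) := by
    rw [hc]; ring
  rw [e3, ← mul_assoc]
  congr 1
  have h4 : 1 + y ≠ 0 := fun h => h1 (by linear_combination (1 - y) * h)
  have e4 : 1 - y ^ 2 = (1 - y) * (1 + y) := by ring
  rw [e4]
  field_simp

/-- By the product formula, replacing x_i by q^e x_i changes only the factors of Δ containing x_i,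
and their ratio is the coefficient up to s^{-e}. That scalar is the effect of the shift on the
factor x_i^{-1/2} by which Δ differs from the true Weyl denominator. -/
theorem koornwinderCoeff_mul_weylNum {n : ℕ} {q s : ℂ} (hq : q ≠ 0) (hs : s ^ 2 = q)
    (hα : q ^ (1 / 2 : ℂ) = s) (i : Fin n) {e : ℤ} (he : e = 1 ∨ e = -1) :
    koornwinderCoeff s (-s) (-1) q q q i (toRat n (varL e i)) *
        toRat n (weylNum fun _ => 0) =
      toRat n (s ^ (-e) • shiftHom i (Units.mk0 q hq ^ e) (weylNum fun _ => 0)) := by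
  have hx : xVar i ≠ 0 := xVar_ne_zero i
  have hs0 : s ≠ 0 := by rintro rfl; simp at hs; exact hq hs.symm
  have hq' : constRat n q ≠ 0 := constRat_ne_zero hq
  have hs' : constRat n s ≠ 0 := constRat_ne_zero hs0
  have hc : constRat n q = constRat n s ^ 2 := by rw [← hs]; simp [constRat]
  have hx1 : xVar i - 1 ≠ 0 := by
    rw [sub_ne_zero]; exact toRat_ne_one (single_one_ne_zero i one_ne_zero)
  have hprod : ∏ j ∈ Finset.univ.erase i,
      ((xVar i + (xVar i)⁻¹) - (xVar j + (xVar j)⁻¹)) ≠ 0 := by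
    refine Finset.prod_ne_zero_iff.2 fun j hj => sub_ne_zero.2 fun h => ?_
    rw [xVar_inv, xVar_inv, ← toRat_varL_one, ← toRat_varL_one, ← map_add, ← map_add] at h
    exact varL_add_varL_ne (Finset.ne_of_mem_erase hj).symm (toRat_injective n h)
  rw [koornwinderCoeff_BB hq hs hα i he, smul_eq_constRat]
  have hT : toRat n (shiftHom i (Units.mk0 q hq ^ e) (weylNum fun _ => 0)) =
      altDet (Function.update xVar i (constRat n (q ^ e) * xVar i))
        (Function.update (fun j => (xVar j)⁻¹) i (constRat n (q ^ e) * xVar i)⁻¹)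
        fun j => n - 1 - (j : ℕ) := by
    rw [shiftHom_weylNum_zero, altDet_map]
    congr 1
    · ext1 j
      rcases eq_or_ne j i with rfl | h
      · simp [smul_eq_constRat, xVar]
      · simp [h, xVar]
    · ext1 j
      rcases eq_or_ne j i with rfl | h
      · simp [smul_eq_constRat, xVar_inv, constRat, mul_comm]
      · simp [h, xVar_inv]
  have hA : toRat n (weylNum fun _ => 0) =
      altDet xVar (fun j => (xVar j)⁻¹) fun j => n - 1 - (j : ℕ) := by
    rw [weylNum_zero, altDet_map]
    simp only [← xVar_inv]
    rfl
  have hqe : constRat n (q ^ e) ≠ 0 := constRat_ne_zero (zpow_ne_zero _ hq)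
  have key := altDet_rho_update (xVar (n := n)) (fun j => (xVar j)⁻¹)
    (fun j => mul_inv_cancel₀ (xVar_ne_zero j)) i (constRat n (q ^ e) * xVar i)
    (constRat n (q ^ e) * xVar i)⁻¹ (mul_inv_cancel₀ (mul_ne_zero hqe hx))
  rw [← hT, ← hA] at key
  rw [Finset.prod_div_distrib]
  rw [← mul_right_inj' (mul_ne_zero hx1 hprod)]
  have key' := congrArg (constRat n (s ^ (-e)) * ·) key
  simp only at key'
  generalize toRat n (shiftHom i (Units.mk0 q hq ^ e) (weylNum fun _ => 0)) = T at *
  generalize toRat n (weylNum fun _ => 0) = A at *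
  rw [mul_comm ((xVar i - 1) * _) (constRat n (s ^ (-e)) * T), mul_assoc (constRat n _) T, key']
  have hY : constRat n q * toRat n (varL e i) + (constRat n q * toRat n (varL e i))⁻¹ =
      constRat n (q ^ e) * xVar i + (constRat n (q ^ e) * xVar i)⁻¹ := by
    rcases he with rfl | rfl
    · simp [xVar]
    · rw [← xVar_inv]; simp [constRat, add_comm]; ring
  rw [hY]
  generalize ∏ j ∈ Finset.univ.erase i, (constRat n (q ^ e) * xVar i +
    (constRat n (q ^ e) * xVar i)⁻¹ - (xVar j + (xVar j)⁻¹)) = N at *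
  generalize ∏ j ∈ Finset.univ.erase i,
      ((xVar i + (xVar i)⁻¹) - (xVar j + (xVar j)⁻¹)) = D at *
  have hx2 : 1 - xVar i ≠ 0 := fun h => hx1 (by linear_combination -h)
  rcases he with rfl | rfl
  · rw [toRat_varL_one]
    simp only [zpow_one, zpow_neg]
    rw [show constRat n s⁻¹ = (constRat n s)⁻¹ by simp [constRat]]
    field_simp
    ring
  · rw [← xVar_inv]
    simp only [zpow_one, zpow_neg, inv_inv]
    rw [show constRat n q⁻¹ = (constRat n q)⁻¹ by simp [constRat]]
    field_simp
    rw [hc]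
    ring

/-! ### The conjugated operator, diagonal on monomials -/

/-- The diagonal operator `∑_i (s⁻¹ T_{q,x_i} + s T_{q,x_i}⁻¹)`. -/
noncomputable def shiftSum {n : ℕ} {q : ℂ} (hq : q ≠ 0) (s : ℂ) :
    LaurentPoly n →ₗ[ℂ] LaurentPoly n :=
  ∑ i : Fin n, (s ^ (-1 : ℤ) • (shiftHom i (Units.mk0 q hq ^ (1 : ℤ))).toLinearMap +
    s ^ (-(-1) : ℤ) • (shiftHom i (Units.mk0 q hq ^ (-1 : ℤ))).toLinearMap)

/-- Shifts are multiplicative, so T(Δ)·T(f) = T(Δf); the −1 in T − 1 accounts for the subtracted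
term. -/
theorem weylNum_mul_koornwinderOp {n : ℕ} {q s : ℂ} (hq : q ≠ 0) (hs : s ^ 2 = q)
    (hα : q ^ (1 / 2 : ℂ) = s) (f : LaurentPoly n) :
    toRat n (weylNum fun _ => 0) * koornwinderOp s (-s) (-1) q q q f =
      toRat n (shiftSum hq s ((weylNum fun _ => 0) * f) -
        shiftSum hq s (weylNum fun _ => 0) * f) := by
  simp only [koornwinderOp, shiftSum, LinearMap.sum_apply, LinearMap.add_apply,
    LinearMap.smul_apply, AlgHom.toLinearMap_apply, Finset.sum_mul, Finset.mul_sum,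
    ← Finset.sum_sub_distrib]
  rw [map_sum]
  refine Finset.sum_congr rfl fun i _ => ?_
  have h1 := koornwinderCoeff_mul_weylNum hq hs hα i (e := 1) (Or.inl rfl)
  have h2 := koornwinderCoeff_mul_weylNum hq hs hα i (e := -1) (Or.inr rfl)
  have e1 : shiftVar i q f = shiftHom i (Units.mk0 q hq ^ (1 : ℤ)) f := by
    rw [← shiftVar_eq]; simp
  have e2 : shiftVar i q⁻¹ f = shiftHom i (Units.mk0 q hq ^ (-1 : ℤ)) f := by
    rw [← shiftVar_eq]; simp
  rw [toRat_varL_one] at h1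
  rw [← xVar_inv] at h2
  rw [e1, e2]
  simp only [map_mul, map_sub, map_add, smul_eq_constRat] at h1 h2 ⊢
  linear_combination (toRat n (shiftHom i (Units.mk0 q hq ^ (1 : ℤ)) f) - toRat n f) * h1 +
    (toRat n (shiftHom i (Units.mk0 q hq ^ (-1 : ℤ)) f) - toRat n f) * h2

/-- The eigenvalue of `shiftSum` on the monomial with exponent `κ`. -/
noncomputable def shiftEigenvalue {n : ℕ} (s : ℂ) (κ : Fin n → ℤ) : ℂ :=
  ∑ i, (s ^ (2 * κ i - 1) + s ^ (-(2 * κ i - 1)))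

theorem shiftSum_monom {n : ℕ} {q s : ℂ} (hq : q ≠ 0) (hs : s ^ 2 = q) (κ : Fin n → ℤ) :
    shiftSum hq s (monom κ) = shiftEigenvalue s κ • monom κ := by
  have hs0 : s ≠ 0 := by rintro rfl; simp at hs; exact hq hs.symm
  simp only [shiftSum, LinearMap.sum_apply, LinearMap.add_apply,
    LinearMap.smul_apply, AlgHom.toLinearMap_apply, shiftEigenvalue, Finset.sum_smul]
  refine Finset.sum_congr rfl fun i _ => ?_
  have h : ∀ m : ℤ, q ^ m = s ^ (2 * m) := fun m => by
    rw [← hs, ← zpow_natCast, ← zpow_mul]; rfl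
  rw [shiftHom_monom, shiftHom_monom, smul_smul, smul_smul, ← add_smul]
  congr 2
  · simp only [zpow_one, Units.val_mk0]
    rw [h, ← zpow_add₀ hs0]; congr 1; ring
  · simp only [zpow_neg, zpow_one, Units.val_inv_eq_inv_val, Units.val_mk0, inv_inv]
    rw [inv_zpow, h, ← zpow_neg, ← zpow_one_add₀ hs0, ← zpow_neg]; congr 1; ring

theorem shiftSum_coeff {n : ℕ} {q s : ℂ} (hq : q ≠ 0) (hs : s ^ 2 = q) (f : LaurentPoly n)
    (κ : Fin n → ℤ) : (shiftSum hq s f).coeff κ = shiftEigenvalue s κ * f.coeff κ := by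
  induction f using AddMonoidAlgebra.induction_linear with
  | zero => simp
  | add f g hf hg => simp [hf, hg, mul_add]
  | single μ c =>
    have : AddMonoidAlgebra.single μ c = c • monom μ := by simp [monom]
    rw [this, map_smul, shiftSum_monom hq hs]
    rcases eq_or_ne μ κ with rfl | h
    · simp [monom, mul_comm]
    · simp [monom, h]

/-! ### Signed permutations centred at (1/2, …, 1/2) and alternating sums -/

/-- The product of signed permutations. -/
def wMul {n : ℕ} (u w : (Fin n → ℤˣ) × Equiv.Perm (Fin n)) :
    (Fin n → ℤˣ) × Equiv.Perm (Fin n) := (fun i => u.1 i * w.1 (u.2 i), w.2 * u.2)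

theorem signedPerm_wMul {n : ℕ} (u w : (Fin n → ℤˣ) × Equiv.Perm (Fin n)) (μ : Fin n → ℤ) :
    signedPerm (wMul u w) μ = signedPerm u (signedPerm w μ) := by
  ext i; simp [signedPerm, wMul, mul_assoc]

theorem wMul_left_bijective {n : ℕ} (u : (Fin n → ℤˣ) × Equiv.Perm (Fin n)) :
    Function.Bijective (fun w => wMul w u) := by
  refine Finite.injective_iff_bijective.1 fun w w' h => ?_
  simp only [wMul, Prod.mk.injEq] at h
  have h2 : w.2 = w'.2 := mul_left_cancel h.2
  refine Prod.ext (funext fun i => ?_) h2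
  have := congrFun h.1 i
  rw [h2] at this
  exact mul_right_cancel this

/-- The sign character of the hyperoctahedral group. -/
def wSign {n : ℕ} (w : (Fin n → ℤˣ) × Equiv.Perm (Fin n)) : ℤˣ :=
  Equiv.Perm.sign w.2 * ∏ i, w.1 i

theorem wSign_wMul {n : ℕ} (u w : (Fin n → ℤˣ) × Equiv.Perm (Fin n)) :
    wSign (wMul u w) = wSign u * wSign w := by
  simp only [wSign, wMul, Equiv.Perm.sign_mul, Finset.prod_mul_distrib]
  rw [Equiv.prod_comp u.2 w.1]
  simp only [mul_comm, mul_left_comm, mul_assoc]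

theorem signedPerm_injective {n : ℕ} (w : (Fin n → ℤˣ) × Equiv.Perm (Fin n)) :
    Function.Injective (signedPerm w) := by
  intro μ ν h
  ext i
  have := congrFun h (w.2.symm i)
  simpa [signedPerm] using this

theorem signedPerm_add {n : ℕ} (w : (Fin n → ℤˣ) × Equiv.Perm (Fin n)) (μ ν : Fin n → ℤ) :
    signedPerm w (μ + ν) = signedPerm w μ + signedPerm w ν := by
  ext i; simp [signedPerm, mul_add]

theorem signedPerm_smul {n : ℕ} (w : (Fin n → ℤˣ) × Equiv.Perm (Fin n)) (c : ℤ)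
    (μ : Fin n → ℤ) : signedPerm w (c • μ) = c • signedPerm w μ := by
  ext i; simp [signedPerm, mul_left_comm]

/-- The action of signed permutations centred at `(1/2, ..., 1/2)`. -/
def centredAct {n : ℕ} (w : (Fin n → ℤˣ) × Equiv.Perm (Fin n)) (κ : Fin n → ℤ) : Fin n → ℤ :=
  fun i => if w.1 i = 1 then κ (w.2 i) else 1 - κ (w.2 i)

/-- Twice the difference from the centre `(1/2, ..., 1/2)`. -/
def centred {n : ℕ} (κ : Fin n → ℤ) : Fin n → ℤ := fun i => 2 * κ i - 1

theorem centred_injective {n : ℕ} : Function.Injective (centred (n := n)) := by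
  intro κ κ' h
  ext i
  have := congrFun h i
  simp only [centred] at this
  omega

theorem centred_add {n : ℕ} (κ μ : Fin n → ℤ) : centred (κ + μ) = centred κ + (2 : ℤ) • μ := by
  ext i; simp [centred]; ring

/-- Doubling turns the affine action about the half-integral centre into the linear one, while all
exponents stay integral. -/
theorem centred_centredAct {n : ℕ} (w : (Fin n → ℤˣ) × Equiv.Perm (Fin n)) (κ : Fin n → ℤ) :
    centred (centredAct w κ) = signedPerm w (centred κ) := by
  ext i
  simp only [centred, centredAct, signedPerm]
  rcases Int.units_eq_one_or (w.1 i) with h | h <;> simp [h]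
  ring

theorem centredAct_wMul {n : ℕ} (u w : (Fin n → ℤˣ) × Equiv.Perm (Fin n)) (κ : Fin n → ℤ) :
    centredAct (wMul u w) κ = centredAct u (centredAct w κ) := by
  apply centred_injective
  simp only [centred_centredAct, signedPerm_wMul]

theorem centredAct_add {n : ℕ} (w : (Fin n → ℤˣ) × Equiv.Perm (Fin n)) (κ μ : Fin n → ℤ) :
    centredAct w (κ + μ) = centredAct w κ + signedPerm w μ := by
  apply centred_injective
  simp only [centred_centredAct, centred_add, signedPerm_add, signedPerm_smul]

/-- The antisymmetrization of a monomial. -/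
noncomputable def anti {n : ℕ} (κ : Fin n → ℤ) : LaurentPoly n :=
  ∑ w : (Fin n → ℤˣ) × Equiv.Perm (Fin n), ((wSign w : ℤ) : ℂ) • monom (centredAct w κ)

theorem units_int_cast_mul_self (e : ℤˣ) : ((e : ℤ) : ℂ) * ((e : ℤ) : ℂ) = 1 := by
  rw [← Int.cast_mul, ← Units.val_mul, Int.units_mul_self]; simp

theorem anti_centredAct {n : ℕ} (u : (Fin n → ℤˣ) × Equiv.Perm (Fin n)) (κ : Fin n → ℤ) :
    anti (centredAct u κ) = ((wSign u : ℤ) : ℂ) • anti κ := by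
  have h : anti κ = ∑ w, ((wSign (wMul w u) : ℤ) : ℂ) • monom (centredAct (wMul w u) κ) :=
    ((wMul_left_bijective u).sum_comp fun w =>
      ((wSign w : ℤ) : ℂ) • monom (centredAct w κ)).symm
  rw [h, anti, Finset.smul_sum]
  refine Finset.sum_congr rfl fun w _ => ?_
  rw [smul_smul, centredAct_wMul, wSign_wMul]
  congr 1
  push_cast
  linear_combination -((wSign w : ℤ) : ℂ) * units_int_cast_mul_self (wSign u)

/-- The transposition of i and j fixes κ and has sign −1, so the alternating sum equals its own
negative. -/
theorem anti_eq_zero {n : ℕ} {κ : Fin n → ℤ} {i j : Fin n} (hij : i ≠ j) (h : κ i = κ j) :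
    anti κ = 0 := by
  have h1 := anti_centredAct (1, Equiv.swap i j) κ
  have h2 : centredAct (1, Equiv.swap i j) κ = κ := by
    ext k
    simp only [centredAct, Pi.one_apply, if_true]
    rcases eq_or_ne k i with rfl | hi
    · simp [h]
    rcases eq_or_ne k j with rfl | hj
    · simp [h]
    rw [Equiv.swap_apply_of_ne_of_ne hi hj]
  rw [h2] at h1
  simp only [wSign, Equiv.Perm.sign_swap hij, Pi.one_apply, Finset.prod_const_one, mul_one,
    Units.val_neg, Units.val_one, Int.cast_neg, Int.cast_one, neg_smul, one_smul] at h1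
  have h3 : (2 : ℂ) • anti κ = 0 := by
    rw [two_smul]; nth_rewrite 2 [h1]; exact add_neg_cancel _
  exact (smul_eq_zero.1 h3).resolve_left two_ne_zero

/-- Sort the entries by decreasing |2κ_i − 1| and choose signs making 2κ_i − 1 nonnegative;
integrality then gives κ_i ≥ 1. -/
theorem exists_centredAct_dominant {n : ℕ} (κ : Fin n → ℤ) :
    ∃ u, Antitone (centredAct u κ) ∧ ∀ i, 0 < centredAct u κ i := by
  have hs := Tuple.monotone_sort (fun i => -|centred κ i|)
  set σ := Tuple.sort (fun i => -|centred κ i|)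
  have hc : ∀ i, centred (centredAct ((fun i => if 0 ≤ centred κ (σ i) then 1 else -1), σ) κ) i =
      |centred κ (σ i)| := by
    intro i
    rw [centred_centredAct, signedPerm]
    dsimp only
    split_ifs with h
    · simp [abs_of_nonneg h]
    · simp [abs_of_neg (not_le.1 h)]
  refine ⟨((fun i => if 0 ≤ centred κ (σ i) then 1 else -1), σ), fun i j hij => ?_, fun i => ?_⟩
  · have h1 := hc i
    have h2 := hc j
    have h3 := hs hij
    simp only [centred, Function.comp_apply] at h1 h2 h3
    unfold centred at h1 h2 ⊢
    omega
  · have h1 := hc i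
    have := abs_nonneg (centred κ (σ i))
    rw [← h1, centred] at this
    omega

theorem monom_sum {n : ℕ} {ι : Type*} (t : Finset ι) (f : ι → Fin n → ℤ) :
    monom (∑ i ∈ t, f i) = ∏ i ∈ t, monom (f i) := by
  classical
  induction t using Finset.induction_on with
  | empty => simp [monom_zero]
  | insert a t ha ih => rw [Finset.sum_insert ha, Finset.prod_insert ha, ← monom_mul, ih]

/-- The exponent of the leading monomial of `weylNum lam`. -/
def leadExp {n : ℕ} (lam : Fin n → ℕ) : Fin n → ℤ :=
  fun j => ((lam j + (n - 1 - (j : ℕ)) + 1 : ℕ) : ℤ)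

/-- In the Leibniz expansion every matrix entry is a difference of two monomials, exchanged by κ ↦ 1
− κ; choosing one from each entry amounts to choosing a sign vector. -/
theorem weylNum_eq_anti {n : ℕ} (lam : Fin n → ℕ) : weylNum lam = anti (leadExp lam) := by
  rw [weylNum, altDet, ← Matrix.det_transpose, Matrix.det_apply', anti, Fintype.sum_prod_type_right]
  refine Finset.sum_congr rfl fun σ _ => ?_
  simp only [Matrix.transpose_apply, Matrix.of_apply]
  have hpow : ∀ (e : ℤ) (i : Fin n) (k : ℕ), varL e i ^ k = monom (Pi.single i (e * k)) := by
    intro e i k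
    simp only [varL, monom]
    rw [AddMonoidAlgebra.single_pow, one_pow, ← Pi.single_smul]
    simp [mul_comm]
  have hterm : ∀ i : Fin n, varL 1 (i) ^ (lam (σ i) + (n - 1 - (σ i : ℕ)) + 1) -
      varL (-1) (i) ^ (lam (σ i) + (n - 1 - (σ i : ℕ))) =
      ∑ ε : ℤˣ, ((ε : ℤ) : ℂ) • monom (Pi.single i
        (if ε = 1 then leadExp lam (σ i) else 1 - leadExp lam (σ i))) := by
    intro i
    rw [hpow, hpow]
    have : (Finset.univ : Finset ℤˣ) = {1, -1} := rfl
    rw [this, Finset.sum_pair (by decide)]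
    simp [leadExp, sub_eq_add_neg]
  rw [Finset.prod_congr rfl fun i _ => hterm i, Finset.prod_univ_sum, Fintype.piFinset_univ,
    Finset.mul_sum]
  refine Finset.sum_congr rfl fun ε _ => ?_
  have h1 : ∏ i, monom (Pi.single i (if ε i = 1 then leadExp lam (σ i)
      else 1 - leadExp lam (σ i)) : Fin n → ℤ) = monom (centredAct (ε, σ) (leadExp lam)) := by
    rw [← monom_sum, Finset.univ_sum_single]; rfl
  rw [Finset.prod_smul, h1, wSign, ← zsmul_eq_mul, Units.val_mul, Int.cast_mul,
    mul_smul, Int.cast_smul_eq_zsmul]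
  simp

/-- A strictly dominant exponent is the leading exponent attached to a partition. -/
theorem exists_leadExp_eq {n : ℕ} {κ : Fin n → ℤ} (h : StrictAnti κ) (h0 : ∀ i, 0 < κ i) :
    ∃ nu : Fin n → ℕ, IsPartition nu ∧ leadExp nu = κ := by
  obtain _ | m := n
  · exact ⟨fun _ => 0, fun _ _ _ => le_rfl, funext fun i => i.elim0⟩
  have ha : Antitone fun i : Fin (m + 1) => κ i + (i : ℤ) := by
    refine Fin.antitone_iff_succ_le.2 fun i => ?_
    have := h (Fin.castSucc_lt_succ (i := i))
    simp only [Fin.val_succ, Fin.val_castSucc, Nat.cast_add, Nat.cast_one]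
    omega
  have hge : ∀ i, (m : ℤ) + 1 ≤ κ i + i := by
    intro i
    have h1 := ha (Fin.le_last i)
    have h2 := h0 (Fin.last m)
    simp only [Fin.val_last] at h1
    omega
  -- This inverts `leadExp`, whose value is λ_i + n − i for i counted from 0; by `hge`, `toNat`
  -- truncates nothing.
  refine ⟨fun i => (κ i + i - (m + 1)).toNat, fun i j hij => ?_, funext fun i => ?_⟩
  · have := ha hij
    simp only at this ⊢
    omega
  · have := hge i
    have := i.2
    simp only [leadExp]
    omega

theorem leadExp_pos {n : ℕ} (lam : Fin n → ℕ) (i : Fin n) : 0 < leadExp lam i := by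
  simp only [leadExp]; omega

theorem leadExp_strictAnti {n : ℕ} {lam : Fin n → ℕ} (h : IsPartition lam) :
    StrictAnti (leadExp lam) := by
  intro i j hij
  have h1 := h hij.le
  have h2 : (i : ℕ) < j := hij
  have := j.2
  simp only [leadExp]
  omega

/-! ### Dominance estimates and products with monomial symmetric polynomials -/

theorem sum_signedPerm_le {n : ℕ} {p : Fin n → ℤ} (hp : Antitone p) (h0 : ∀ i, 0 ≤ p i)
    (w : (Fin n → ℤˣ) × Equiv.Perm (Fin n)) (i : Fin n) :
    ∑ j ∈ Finset.Iic i, signedPerm w p j ≤ ∑ j ∈ Finset.Iic i, p j := by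
  have h1 : ∑ j ∈ Finset.Iic i, signedPerm w p j ≤ ∑ j ∈ Finset.Iic i, p (w.2 j) := by
    refine Finset.sum_le_sum fun j _ => ?_
    have := h0 (w.2 j)
    rw [signedPerm]
    rcases Int.units_eq_one_or (w.1 j) with h | h <;> simp [h]
    omega
  -- Rearrangement inequality: the indicator of an initial segment decreases, as does p.
  have hm : Monovary (fun j => if j ≤ i then (1 : ℤ) else 0) p := by
    refine Antitone.monovary (fun j k hjk => ?_) hp
    split_ifs with h1 h2 <;> omega
  have h2 := hm.sum_mul_comp_perm_le_sum_mul (σ := w.2)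
  have hI : Finset.Iic i = Finset.univ.filter (· ≤ i) := by ext; simp
  simp only [ite_mul, one_mul, zero_mul, ← Finset.sum_filter, ← hI] at h2
  exact h1.trans h2

theorem eq_of_sum_Iic_eq {n : ℕ} {M : Type*} [AddCommGroup M] {f g : Fin n → M}
    (h : ∀ i, ∑ j ∈ Finset.Iic i, f j = ∑ j ∈ Finset.Iic i, g j) : f = g := by
  have hI : ∀ i : Fin n, Finset.Iic i = insert i (Finset.Iio i) := by
    intro i; ext j; simp [le_iff_eq_or_lt]
  ext i
  have h1 := h i
  rw [hI, Finset.sum_insert (by simp), Finset.sum_insert (by simp)] at h1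
  suffices h2 : ∑ j ∈ Finset.Iio i, f j = ∑ j ∈ Finset.Iio i, g j by
    rw [h2] at h1; exact add_right_cancel h1
  rcases i with ⟨k, hk⟩
  obtain _ | k := k
  · have : Finset.Iio (⟨0, hk⟩ : Fin n) = ∅ := by ext j; simp [Fin.lt_def]
    simp [this]
  · have : Finset.Iio (⟨k + 1, hk⟩ : Fin n) = Finset.Iic ⟨k, by omega⟩ := by
      ext j; simp [Fin.lt_def, Fin.le_def]
    rw [this]; exact h _

/-- A regular dominant weight has trivial stabilizer. Applied to 2ρ, this leaves λ as the only orbit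
element contributing N_λ. -/
theorem eq_one_of_signedPerm_eq {n : ℕ} {p : Fin n → ℤ} (hp : Function.Injective p)
    (h0 : ∀ i, 0 < p i) {w : (Fin n → ℤˣ) × Equiv.Perm (Fin n)} (h : signedPerm w p = p) :
    w = (1, 1) := by
  have h1 : ∀ i, w.1 i = 1 ∧ w.2 i = i := by
    intro i
    have hi := congrFun h i
    have := h0 (w.2 i)
    have := h0 i
    rw [signedPerm] at hi
    rcases Int.units_eq_one_or (w.1 i) with h | h
    · rw [h] at hi
      exact ⟨h, hp (by simpa using hi)⟩
    · rw [h] at hi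
      simp at hi
      omega
  exact Prod.ext (funext fun i => (h1 i).1) (Equiv.ext fun i => (h1 i).2)

theorem mem_orbitW {n : ℕ} {lam : Fin n → ℕ} {μ : Fin n → ℤ} :
    μ ∈ orbitW lam ↔ ∃ w, signedPerm w (fun i => (lam i : ℤ)) = μ := by
  simp [orbitW]

theorem signedPerm_mem_orbitW {n : ℕ} {lam : Fin n → ℕ} {μ : Fin n → ℤ}
    (h : μ ∈ orbitW lam) (w : (Fin n → ℤˣ) × Equiv.Perm (Fin n)) :
    signedPerm w μ ∈ orbitW lam := by
  obtain ⟨u, rfl⟩ := mem_orbitW.1 h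
  rw [← signedPerm_wMul]
  exact mem_orbitW.2 ⟨_, rfl⟩

theorem sum_orbitW_signedPerm {n : ℕ} {M : Type*} [AddCommMonoid M] (lam : Fin n → ℕ)
    (w : (Fin n → ℤˣ) × Equiv.Perm (Fin n)) (f : (Fin n → ℤ) → M) :
    ∑ μ ∈ orbitW lam, f (signedPerm w μ) = ∑ μ ∈ orbitW lam, f μ := by
  refine Finset.sum_nbij (signedPerm w) (fun μ h => signedPerm_mem_orbitW h w)
    (signedPerm_injective w).injOn ?_ fun _ _ => rfl
  exact Finset.surjOn_of_injOn_of_card_le _ (fun μ h => signedPerm_mem_orbitW h w)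
    (signedPerm_injective w).injOn le_rfl

/-- Since m_λ is invariant, its orbit may be reindexed by w separately in each term of the
alternating sum. -/
theorem anti_mul_monomialSymm {n : ℕ} (κ : Fin n → ℤ) (lam : Fin n → ℕ) :
    anti κ * monomialSymm lam = ∑ μ ∈ orbitW lam, anti (κ + μ) := by
  simp only [anti]
  rw [Finset.sum_comm, Finset.sum_mul]
  refine Finset.sum_congr rfl fun w _ => ?_
  simp only [centredAct_add]
  rw [sum_orbitW_signedPerm lam w fun μ => ((wSign w : ℤ) : ℂ) • monom (centredAct w κ + μ),
    monomialSymm, Finset.mul_sum]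
  refine Finset.sum_congr rfl fun μ _ => ?_
  rw [smul_mul_assoc, monom_mul]

theorem leadExp_eq_add {n : ℕ} (lam : Fin n → ℕ) :
    leadExp lam = leadExp (fun _ => 0) + fun i => (lam i : ℤ) := by
  ext i; simp [leadExp]; ring

/-- The terms of the product of the Weyl denominator and a monomial symmetric polynomial. -/
theorem anti_leadExp_add {n : ℕ} {lam : Fin n → ℕ} (hlam : IsPartition lam) {μ : Fin n → ℤ}
    (hμ : μ ∈ orbitW lam) (hne : μ ≠ fun i => (lam i : ℤ)) :
    anti (leadExp (fun _ => 0) + μ) ∈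
      Submodule.span ℂ {f | ∃ nu : Fin n → ℕ, IsPartition nu ∧ DomLT nu lam ∧ f = weylNum nu} := by
  set κ := leadExp (fun _ => 0) + μ with hκ
  obtain ⟨u, hu, hu0⟩ := exists_centredAct_dominant κ
  suffices h : anti (centredAct u κ) ∈
      Submodule.span ℂ {f | ∃ nu : Fin n → ℕ, IsPartition nu ∧ DomLT nu lam ∧ f = weylNum nu} by
    have h1 : anti κ = ((wSign u : ℤ) : ℂ) • anti (centredAct u κ) := by
      rw [anti_centredAct, smul_smul, units_int_cast_mul_self, one_smul]
    rw [h1]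
    exact Submodule.smul_mem _ _ h
  by_cases hinj : Function.Injective (centredAct u κ)
  swap
  · obtain ⟨i, j, h, hij⟩ := by simpa [Function.Injective] using hinj
    rw [anti_eq_zero hij h]
    exact Submodule.zero_mem _
  obtain ⟨nu, hnu, hnu'⟩ := exists_leadExp_eq (hu.strictAnti_of_injective hinj) hu0
  rw [← hnu', ← weylNum_eq_anti]
  refine Submodule.subset_span ⟨nu, hnu, ?_, rfl⟩
  obtain ⟨w, rfl⟩ := mem_orbitW.1 hμ
  set l : Fin n → ℤ := fun i => (lam i : ℤ) with hl
  set p := centred (leadExp fun _ : Fin n => 0) with hp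
  have hl_anti : Antitone l := fun i j hij => by simpa [hl] using hlam hij
  have hp_strict : StrictAnti p := fun i j hij => by
    have := leadExp_strictAnti (lam := fun _ : Fin n => 0) (fun _ _ _ => le_rfl) hij
    simp only [hp, centred]; omega
  have hp_pos : ∀ i, 0 < p i := fun i => by
    have := leadExp_pos (fun _ : Fin n => 0) i
    simp only [hp, centred]; omega
  -- Twice the identity ρ + ν = uρ + (uw)λ, with p = 2ρ. Partial sums of uρ and (uw)λ are at most
  -- those of ρ and λ, so ν ≤ λ; if ν = λ, both bounds are equalities, which forces u = 1 and then μ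
  -- = λ.
  have heq : p + (2 : ℤ) • (fun i => (nu i : ℤ)) =
      signedPerm u p + (2 : ℤ) • signedPerm (wMul u w) l := by
    rw [hp, ← centred_add, ← leadExp_eq_add, hnu', centred_centredAct, hκ, centred_add,
      signedPerm_add, signedPerm_smul, signedPerm_wMul]
  have hsum : ∀ i, ∑ j ∈ Finset.Iic i, p j + 2 * ∑ j ∈ Finset.Iic i, (nu j : ℤ) =
      ∑ j ∈ Finset.Iic i, signedPerm u p j +
        2 * ∑ j ∈ Finset.Iic i, signedPerm (wMul u w) l j := by
    intro i
    have := congrArg (fun f : Fin n → ℤ => ∑ j ∈ Finset.Iic i, f j) heq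
    simpa [Finset.sum_add_distrib, Finset.mul_sum] using this
  have hle1 := fun i => sum_signedPerm_le hp_strict.antitone (fun i => (hp_pos i).le) u i
  have hle2 := fun i => sum_signedPerm_le hl_anti (fun i => by simp [hl]) (wMul u w) i
  refine ⟨?_, fun i => ?_⟩
  · rintro rfl
    have hu1 : u = (1, 1) := by
      refine eq_one_of_signedPerm_eq hp_strict.injective hp_pos (eq_of_sum_Iic_eq fun i => ?_)
      have h1 := hsum i
      have h2 := hle1 i
      have h3 := hle2 i
      simp only [hl] at h1 h3
      omega
    have h2 : signedPerm (wMul u w) l = l := by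
      refine eq_of_sum_Iic_eq fun i => ?_
      have h1 := hsum i
      have h2 := hle1 i
      have h3 := hle2 i
      simp only [hl] at h1 h3 ⊢
      omega
    apply hne
    rw [signedPerm_wMul, hu1] at h2
    refine Eq.trans ?_ h2
    ext i
    simp [signedPerm]
  · have h1 := hsum i
    have h2 := hle1 i
    have h3 := hle2 i
    have h4 : ∑ j ∈ Finset.Iic i, (nu j : ℤ) ≤ ∑ j ∈ Finset.Iic i, l j := by omega
    simp only [hl] at h4
    exact_mod_cast h4

theorem DomLT.trans {n : ℕ} {a b c : Fin n → ℕ} (h : DomLT a b) (h' : DomLT b c) : DomLT a c := by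
  refine ⟨?_, fun i => (h.2 i).trans (h'.2 i)⟩
  rintro rfl
  refine h.1 ?_
  have : (fun i => (a i : ℤ)) = fun i => (b i : ℤ) :=
    eq_of_sum_Iic_eq fun i => by exact_mod_cast (h.2 i).antisymm (h'.2 i)
  ext i
  exact_mod_cast congrFun this i

theorem DomLT.sum_lt {n : ℕ} {a b : Fin n → ℕ} (h : DomLT a b) :
    ∑ i, ∑ j ∈ Finset.Iic i, a j < ∑ i, ∑ j ∈ Finset.Iic i, b j := by
  refine (Finset.sum_le_sum fun i _ => h.2 i).lt_of_ne fun he => h.1 ?_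
  have h1 := (Finset.sum_eq_sum_iff_of_le fun i _ => h.2 i).1 he
  have : (fun i => (a i : ℤ)) = fun i => (b i : ℤ) :=
    eq_of_sum_Iic_eq fun i => by exact_mod_cast h1 i (Finset.mem_univ i)
  ext i
  exact_mod_cast congrFun this i

theorem domLT_wellFounded (n : ℕ) : WellFounded (DomLT (n := n)) :=
  Subrelation.wf (fun h => h.sum_lt)
    (InvImage.wf (fun a : Fin n → ℕ => ∑ i, ∑ j ∈ Finset.Iic i, a j) Nat.lt_wfRel.wf)

/-! ### Unitriangularity and divisibility by the Weyl denominator -/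

/-- The span of the values of `F` at the partitions below `lam`. -/
noncomputable def lowerSpan {n : ℕ} (F : (Fin n → ℕ) → LaurentPoly n) (lam : Fin n → ℕ) :
    Submodule ℂ (LaurentPoly n) :=
  Submodule.span ℂ {f | ∃ mu : Fin n → ℕ, IsPartition mu ∧ DomLT mu lam ∧ f = F mu}

theorem mem_lowerSpan {n : ℕ} {F : (Fin n → ℕ) → LaurentPoly n} {mu lam : Fin n → ℕ}
    (h : IsPartition mu) (h' : DomLT mu lam) : F mu ∈ lowerSpan F lam :=
  Submodule.subset_span ⟨mu, h, h', rfl⟩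

theorem lowerSpan_mono {n : ℕ} (F : (Fin n → ℕ) → LaurentPoly n) {mu lam : Fin n → ℕ}
    (h : DomLT mu lam) : lowerSpan F mu ≤ lowerSpan F lam :=
  Submodule.span_mono fun _ ⟨nu, h1, h2, h3⟩ => ⟨nu, h1, h2.trans h, h3⟩

theorem weylNum_mul_monomialSymm {n : ℕ} {lam : Fin n → ℕ} (hlam : IsPartition lam) :
    (weylNum fun _ => 0) * monomialSymm lam - weylNum lam ∈ lowerSpan weylNum lam := by
  have hmem : (fun i => (lam i : ℤ)) ∈ orbitW lam :=
    mem_orbitW.2 ⟨(1, 1), by ext i; simp [signedPerm]⟩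
  rw [weylNum_eq_anti fun _ => 0, anti_mul_monomialSymm, ← Finset.add_sum_erase _ _ hmem,
    ← leadExp_eq_add, ← weylNum_eq_anti, add_sub_cancel_left]
  exact Submodule.sum_mem _ fun μ hμ =>
    anti_leadExp_add hlam (Finset.mem_of_mem_erase hμ) (Finset.ne_of_mem_erase hμ)

/-- Divisibility of the Weyl numerators, with unitriangularity of the quotients. -/
theorem exists_weylNum_mul_eq {n : ℕ} (lam : Fin n → ℕ) (hlam : IsPartition lam) :
    ∃ S : LaurentPoly n, (weylNum fun _ => 0) * S = weylNum lam ∧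
      S - monomialSymm lam ∈ lowerSpan monomialSymm lam := by
  induction lam using (domLT_wellFounded n).induction with
  | _ lam ih =>
    -- By induction every lower numerator is Δ times a combination of lower monomial symmetric
    -- polynomials, so the error Δ·m_λ − N_λ can be divided by Δ and subtracted from m_λ.
    have h1 : lowerSpan weylNum lam ≤ (lowerSpan monomialSymm lam).map
        (LinearMap.mulLeft ℂ (weylNum fun _ => 0)) := by
      refine Submodule.span_le.2 ?_
      rintro _ ⟨mu, hmu, hlt, rfl⟩
      obtain ⟨S, hS, hS'⟩ := ih mu hlt hmu
      refine ⟨S, ?_, hS⟩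
      rw [← sub_add_cancel S (monomialSymm mu)]
      exact Submodule.add_mem _ (lowerSpan_mono _ hlt hS') (mem_lowerSpan hmu hlt)
    obtain ⟨R, hR, hR'⟩ := h1 (weylNum_mul_monomialSymm hlam)
    refine ⟨monomialSymm lam - R, ?_, ?_⟩
    · rw [LinearMap.mulLeft_apply] at hR'
      rw [mul_sub, hR']; ring
    · rw [sub_sub_cancel_left]; exact Submodule.neg_mem _ hR

theorem weylNum_mul_mem {n : ℕ} {lam : Fin n → ℕ} {f : LaurentPoly n}
    (hf : f ∈ lowerSpan monomialSymm lam) :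
    (weylNum fun _ => 0) * f ∈ lowerSpan weylNum lam := by
  have h : lowerSpan monomialSymm lam ≤ (lowerSpan weylNum lam).comap
      (LinearMap.mulLeft ℂ (weylNum fun _ => 0)) := by
    refine Submodule.span_le.2 ?_
    rintro _ ⟨mu, hmu, hlt, rfl⟩
    rw [SetLike.mem_coe, Submodule.mem_comap, LinearMap.mulLeft_apply,
      ← sub_add_cancel (_ * _) (weylNum mu)]
    exact Submodule.add_mem _ (lowerSpan_mono _ hlt (weylNum_mul_monomialSymm hmu))
      (mem_lowerSpan hmu hlt)
  exact h hf

theorem monomialSymm_invariant {n : ℕ} (lam : Fin n → ℕ) : IsWInvariant (monomialSymm lam) := by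
  intro w μ
  have h : ∀ μ : Fin n → ℤ, (monomialSymm lam).coeff μ = if μ ∈ orbitW lam then 1 else 0 := by
    intro μ
    simp [monomialSymm, monom, Finsupp.single_apply]
  rw [h, h, ← Finset.sum_ite_eq (orbitW lam) (signedPerm w μ) fun _ => (1 : ℂ),
    ← Finset.sum_ite_eq (orbitW lam) μ fun _ => (1 : ℂ),
    ← sum_orbitW_signedPerm lam w fun ν => if signedPerm w μ = ν then (1 : ℂ) else 0]
  simp only [(signedPerm_injective w).eq_iff]

/-- Makes the invariance clause of `IsKoornwinder` a consequence of triangularity. -/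
theorem invariant_of_triangular {n : ℕ} {lam : Fin n → ℕ} {P : LaurentPoly n}
    (h : P - monomialSymm lam ∈ lowerSpan monomialSymm lam) : IsWInvariant P := by
  have hspan : ∀ f ∈ lowerSpan (monomialSymm (n := n)) lam, IsWInvariant f := by
    intro f hf
    induction hf using Submodule.span_induction with
    | mem f hf =>
      obtain ⟨mu, -, -, rfl⟩ := hf
      exact monomialSymm_invariant mu
    | zero => intro w μ; simp
    | add f g _ _ hf hg => intro w μ; simp [hf w μ, hg w μ]
    | smul c f _ hf => intro w μ; simp [hf w μ]
  intro w μ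
  have h1 := hspan _ h w μ
  have h2 := monomialSymm_invariant lam w μ
  simp only [AddMonoidAlgebra.coeff_sub, Finsupp.coe_sub, Pi.sub_apply] at h1
  linear_combination h1 + h2

/-! ### Eigenvalues, the eigenvalue equation and uniqueness -/

theorem shiftEigenvalue_centredAct {n : ℕ} (s : ℂ) (w : (Fin n → ℤˣ) × Equiv.Perm (Fin n))
    (κ : Fin n → ℤ) : shiftEigenvalue s (centredAct w κ) = shiftEigenvalue s κ := by
  have h : ∀ κ : Fin n → ℤ, shiftEigenvalue s κ =
      ∑ i, (s ^ centred κ i + s ^ (-centred κ i)) := fun κ => rfl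
  rw [h, h, ← Equiv.sum_comp w.2 fun i => s ^ centred κ i + s ^ (-centred κ i),
    centred_centredAct]
  refine Finset.sum_congr rfl fun i _ => ?_
  rw [signedPerm]
  rcases Int.units_eq_one_or (w.1 i) with h | h <;> simp [h, add_comm]

theorem shiftSum_weylNum {n : ℕ} {q s : ℂ} (hq : q ≠ 0) (hs : s ^ 2 = q) (lam : Fin n → ℕ) :
    shiftSum hq s (weylNum lam) = shiftEigenvalue s (leadExp lam) • weylNum lam := by
  rw [weylNum_eq_anti, anti, map_sum, Finset.smul_sum]
  refine Finset.sum_congr rfl fun w _ => ?_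
  rw [map_smul, shiftSum_monom hq hs, shiftEigenvalue_centredAct, smul_comm]

theorem macdonaldBBEigenvalue_eq {n : ℕ} {q s : ℂ} (hq : q ≠ 0) (hs : s ^ 2 = q)
    (hα : q ^ (1 / 2 : ℂ) = s) (lam : Fin n → ℕ) :
    macdonaldBBEigenvalue q q q lam =
      shiftEigenvalue s (leadExp lam) - shiftEigenvalue s (leadExp fun _ : Fin n => 0) := by
  have hs0 : s ≠ 0 := by rintro rfl; simp at hs; exact hq hs.symm
  rw [macdonaldBBEigenvalue, koornwinderEigenvalue, hα, koornwinderAlpha_BB hq hs, hα,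
    shiftEigenvalue, shiftEigenvalue, ← Finset.sum_sub_distrib]
  refine Finset.sum_congr rfl fun j _ => ?_
  have h : ∀ k : ℕ, s ^ (2 * ((k + 1 : ℕ) : ℤ) - 1) = s * q ^ k := fun k => by
    rw [← hs, ← pow_mul, ← zpow_natCast s (2 * k), ← zpow_one_add₀ hs0]
    congr 1; push_cast; ring
  simp only [angleBracket, leadExp, zpow_neg, h, zero_add]
  rw [pow_add]
  ring

/-- Multiplying by Δ ≠ 0 turns D into L(Δ·) − L(Δ)·, and Δ is an L-eigenvector; d_λ is exactly the
eigenvalue of N_λ minus that of Δ. -/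
theorem eigen_iff {n : ℕ} {q s : ℂ} (hq : q ≠ 0) (hs : s ^ 2 = q)
    (hα : q ^ (1 / 2 : ℂ) = s) (lam : Fin n → ℕ) (P : LaurentPoly n) :
    koornwinderOp s (-s) (-1) q q q P =
        constRat n (macdonaldBBEigenvalue q q q lam) * algebraMap (LaurentPoly n) (RatFun n) P ↔
      shiftSum hq s ((weylNum fun _ => 0) * P) =
        shiftEigenvalue s (leadExp lam) • ((weylNum fun _ => 0) * P) := by
  have hA : toRat n (weylNum fun _ => 0) ≠ 0 := by
    rw [Ne, map_eq_zero_iff _ (toRat_injective n)]; exact weylNum_zero_ne_zero n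
  rw [← mul_right_inj' hA, weylNum_mul_koornwinderOp hq hs hα, ← smul_eq_constRat, ← map_mul,
    (toRat_injective n).eq_iff, shiftSum_weylNum hq hs, macdonaldBBEigenvalue_eq hq hs hα, sub_smul,
    mul_sub, mul_smul_comm, mul_smul_comm, smul_mul_assoc]
  exact sub_left_inj

theorem isMacdonaldBB_iff {n : ℕ} {q s : ℂ} (hq : q ≠ 0) (hs : s ^ 2 = q)
    (hα : q ^ (1 / 2 : ℂ) = s) (lam : Fin n → ℕ) (P : LaurentPoly n) :
    IsMacdonaldBB q q q lam P ↔ P - monomialSymm lam ∈ lowerSpan monomialSymm lam ∧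
      shiftSum hq s ((weylNum fun _ => 0) * P) =
        shiftEigenvalue s (leadExp lam) • ((weylNum fun _ => 0) * P) := by
  have hd : macdonaldBBEigenvalue q q q lam =
    koornwinderEigenvalue s (-s) (-1) q q q lam := by rw [macdonaldBBEigenvalue, hα]
  rw [← eigen_iff hq hs hα, hd, IsMacdonaldBB, hα]
  exact ⟨fun h => ⟨h.triangular, h.eigen⟩, fun h => ⟨invariant_of_triangular h.1, h.1, h.2⟩⟩

/-- Weights below `lam` with a different eigenvalue do not meet the eigenspace of `lam`. -/
theorem eq_zero_of_mem_lowerSpan {n : ℕ} {q s : ℂ} (hq : q ≠ 0) (hs : s ^ 2 = q)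
    {lam : Fin n → ℕ} (hne : ∀ mu : Fin n → ℕ, IsPartition mu → DomLT mu lam →
      shiftEigenvalue s (leadExp mu) ≠ shiftEigenvalue s (leadExp lam))
    {g : LaurentPoly n} (hg : g ∈ lowerSpan weylNum lam)
    (he : shiftSum hq s g = shiftEigenvalue s (leadExp lam) • g) : g = 0 := by
  -- The support of g lies in the eigenvalue of λ because g is an eigenvector; `h2` says g has no
  -- coefficient there, being a combination of numerators with other eigenvalues.
  have h1 : ∀ κ, g.coeff κ ≠ 0 → shiftEigenvalue s κ = shiftEigenvalue s (leadExp lam) := by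
    intro κ hκ
    have := congrArg (fun f : LaurentPoly n => f.coeff κ) he
    simp only [shiftSum_coeff hq hs, AddMonoidAlgebra.coeff_smul, Finsupp.smul_apply,
      smul_eq_mul] at this
    exact mul_right_cancel₀ hκ this
  have h2 : ∀ κ, shiftEigenvalue s κ = shiftEigenvalue s (leadExp lam) → g.coeff κ = 0 := by
    intro κ hκ
    clear he h1
    induction hg using Submodule.span_induction with
    | mem f hf =>
      obtain ⟨mu, hmu, hlt, rfl⟩ := hf
      have := congrArg (fun f : LaurentPoly n => f.coeff κ) (shiftSum_weylNum hq hs mu)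
      simp only [shiftSum_coeff hq hs, AddMonoidAlgebra.coeff_smul, Finsupp.smul_apply,
        smul_eq_mul] at this
      by_contra h0
      exact hne mu hmu hlt ((mul_right_cancel₀ h0 this).symm.trans hκ)
    | zero => simp
    | add f g _ _ hf hg => simp [hf, hg]
    | smul c f _ hf => simp [hf]
  ext κ
  by_contra h0
  exact h0 (h2 κ (h1 κ h0))

theorem isMacdonaldBB_of_weylNum_mul_eq {n : ℕ} {q s : ℂ} (hq : q ≠ 0) (hs : s ^ 2 = q)
    (hα : q ^ (1 / 2 : ℂ) = s) {lam : Fin n → ℕ} {S : LaurentPoly n}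
    (hS : (weylNum fun _ => 0) * S = weylNum lam)
    (hS' : S - monomialSymm lam ∈ lowerSpan monomialSymm lam) : IsMacdonaldBB q q q lam S := by
  rw [isMacdonaldBB_iff hq hs hα, hS]
  exact ⟨hS', shiftSum_weylNum hq hs lam⟩

theorem isMacdonaldBB_unique {n : ℕ} {q s : ℂ} (hq : q ≠ 0) (hs : s ^ 2 = q)
    (hα : q ^ (1 / 2 : ℂ) = s) {lam : Fin n → ℕ}
    (hne : ∀ mu : Fin n → ℕ, IsPartition mu → DomLT mu lam →
      macdonaldBBEigenvalue q q q mu ≠ macdonaldBBEigenvalue q q q lam)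
    {P S : LaurentPoly n} (hP : IsMacdonaldBB q q q lam P) (hS : IsMacdonaldBB q q q lam S) :
    P = S := by
  rw [isMacdonaldBB_iff hq hs hα] at hP hS
  have hsub : P - S ∈ lowerSpan monomialSymm lam := by
    have := Submodule.sub_mem _ hP.1 hS.1
    rwa [sub_sub_sub_cancel_right] at this
  have h0 : (weylNum fun _ => 0) * (P - S) = 0 := by
    refine eq_zero_of_mem_lowerSpan hq hs (fun mu hmu hlt h => hne mu hmu hlt ?_)
      (weylNum_mul_mem hsub) ?_
    · rw [macdonaldBBEigenvalue_eq hq hs hα, macdonaldBBEigenvalue_eq hq hs hα, h]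
    · rw [mul_sub, map_sub, hP.2, hS.2, smul_sub]
  exact sub_eq_zero.1 ((mul_eq_zero.1 h0).resolve_left (weylNum_zero_ne_zero n))

theorem schurB_eq {n : ℕ} {lam : Fin n → ℕ} {S : LaurentPoly n}
    (hS : (weylNum fun _ => 0) * S = weylNum lam) : schurB lam = toRat n S := by
  have hA : toRat n (weylNum fun _ => 0) ≠ 0 := by
    rw [Ne, map_eq_zero_iff _ (toRat_injective n)]; exact weylNum_zero_ne_zero n
  rw [schurB, alternantB_eq, alternantB_eq, div_eq_iff hA, ← hS, map_mul, mul_comm]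

/-- Existence selects the branch of `koornwinderP` with a chosen solution, and uniqueness identifies
the choice. -/
theorem macdonaldBB_eq {n : ℕ} {q : ℂ} {lam : Fin n → ℕ} {S : LaurentPoly n}
    (hS : IsMacdonaldBB q q q lam S) (hu : ∀ P, IsMacdonaldBB q q q lam P → P = S) :
    macdonaldBB q q q lam = S := by
  have h : ∃ P, IsKoornwinder (q ^ (1 / 2 : ℂ)) (-q ^ (1 / 2 : ℂ)) (-1) q q q lam P := ⟨S, hS⟩
  rw [macdonaldBB, koornwinderP, dif_pos h]
  exact hu _ h.choose_spec

/-! ### Columns and the separation of their eigenvalues -/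

theorem column_isPartition (n r : ℕ) : IsPartition (column n r) := by
  intro i j hij
  have : (i : ℕ) ≤ j := hij
  simp only [column]
  split_ifs <;> omega

/-- The partitions below a column are shorter columns. -/
theorem eq_column_of_domLT {n r : ℕ} (hr : r ≤ n) {mu : Fin n → ℕ} (hmu : IsPartition mu)
    (h : DomLT mu (column n r)) : ∃ k < r, mu = column n k := by
  obtain _ | m := n
  · exact absurd (funext fun i => i.elim0) h.1
  -- The first dominance inequality bounds the largest part by 1; the last one, on the total sum,
  -- later bounds the number k of ones by r.
  have hle : ∀ i, mu i ≤ 1 := by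
    intro i
    have h0 := h.2 0
    have hI : Finset.Iic (0 : Fin (m + 1)) = {0} := by
      ext j; simp
    rw [hI, Finset.sum_singleton, Finset.sum_singleton] at h0
    have h1 : mu i ≤ mu 0 := hmu (Fin.zero_le i)
    have h2 : column (m + 1) r 0 ≤ 1 := by simp only [column]; split_ifs <;> omega
    omega
  set k := (Finset.univ.filter fun i => mu i = 1).card with hk
  have hkn : k ≤ m + 1 := (Finset.card_filter_le _ _).trans (by simp)
  have hmuk : mu = column (m + 1) k := by
    ext i
    rw [column]
    split_ifs with hi
    · by_contra hne
      have h0 : mu i = 0 := by have := hle i; omega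
      have : (Finset.univ.filter fun j => mu j = 1) ⊆ Finset.Iio i := by
        intro j hj
        simp only [Finset.mem_filter, Finset.mem_univ, true_and, Finset.mem_Iio] at hj ⊢
        by_contra hji
        have := hmu (not_lt.1 hji)
        omega
      have := Finset.card_le_card this
      rw [Fin.card_Iio] at this
      omega
    · by_contra hne
      have h0 : mu i = 1 := by have := hle i; omega
      have : Finset.Iic i ⊆ (Finset.univ.filter fun j => mu j = 1) := by
        intro j hj
        simp only [Finset.mem_filter, Finset.mem_univ, true_and, Finset.mem_Iic] at hj ⊢
        have := hmu hj
        have := hle j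
        omega
      have := Finset.card_le_card this
      rw [Fin.card_Iic] at this
      omega
  have hsum : ∀ p ≤ m + 1, ∑ j ∈ Finset.Iic (Fin.last m), column (m + 1) p j = p := by
    intro p hp
    have hI : Finset.Iic (Fin.last m) = Finset.univ := by ext j; simp [Fin.le_last]
    rw [hI]
    simp only [column, Finset.sum_boole, Nat.cast_id]
    rw [Fin.card_filter_val_lt]
    omega
  refine ⟨k, lt_of_le_of_ne ?_ fun hkr => h.1 (hkr ▸ hmuk), hmuk⟩
  have := h.2 (Fin.last m)
  rwa [hmuk, hsum k hkn, hsum r hr] at this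

theorem shiftEigenvalue_column_succ {n k : ℕ} (hk : k < n) (s : ℂ) :
    shiftEigenvalue s (leadExp (column n (k + 1))) =
      shiftEigenvalue s (leadExp (column n k)) +
        (s ^ (2 * (n - k : ℤ) + 1) + s ^ (-(2 * (n - k : ℤ) + 1)) -
          (s ^ (2 * (n - k : ℤ) - 1) + s ^ (-(2 * (n - k : ℤ) - 1)))) := by
  rw [← sub_eq_iff_eq_add', shiftEigenvalue, shiftEigenvalue, ← Finset.sum_sub_distrib,
    Finset.sum_eq_single ⟨k, hk⟩]
  · have h1 : leadExp (column n (k + 1)) ⟨k, hk⟩ = n - k + 1 := by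
      simp [leadExp, column]; omega
    have h2 : leadExp (column n k) ⟨k, hk⟩ = n - k := by
      simp [leadExp, column]; omega
    rw [h1, h2]
    ring_nf
  · intro i _ hi
    have hik : (i : ℕ) ≠ k := fun h => hi (Fin.ext h)
    have : leadExp (column n (k + 1)) i = leadExp (column n k) i := by
      simp only [leadExp, column]
      congr 3
      split_ifs <;> omega
    rw [this, sub_self]
  · simp

/-- The increments from one column to the next telescope, so comparing columns reduces to comparing
y + y⁻¹ at y = s^{2(n−k)+1}. -/
theorem shiftEigenvalue_column {n k : ℕ} (hk : k ≤ n) (s : ℂ) :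
    shiftEigenvalue s (leadExp (column n k)) + (s ^ (2 * (n - k : ℤ) + 1) + s ^ (-(2 * (n - k : ℤ) + 1)))
      = shiftEigenvalue s (leadExp (column n 0)) + (s ^ (2 * (n : ℤ) + 1) + s ^ (-(2 * (n : ℤ) + 1))) := by
  induction k with
  | zero => simp
  | succ k ih =>
    rw [← ih (by omega), shiftEigenvalue_column_succ (by omega)]
    push_cast
    rw [show 2 * ((n : ℤ) - (k + 1)) + 1 = 2 * (n - k) - 1 by ring]
    ring

/-- The equation factors as (y − z)(yz − 1) = 0, and |yz| < 1 excludes the second factor. -/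
theorem add_inv_inj_of_norm_lt_one {K : Type*} [NormedField K] {y z : K} (hy : y ≠ 0) (hz : z ≠ 0)
    (hy1 : ‖y‖ < 1) (hz1 : ‖z‖ < 1) (h : y + y⁻¹ = z + z⁻¹) : y = z := by
  have h1 : (y - z) * (y * z - 1) = 0 := by
    field_simp at h
    linear_combination h
  rcases mul_eq_zero.1 h1 with h2 | h2
  · exact sub_eq_zero.1 h2
  · have h3 : ‖y * z‖ = 1 := by rw [sub_eq_zero.1 h2, norm_one]
    rw [norm_mul] at h3
    nlinarith [norm_nonneg y, norm_nonneg z]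

/-- Equal eigenvalues would force s^{2(n−k)+1} = s^{2(n−r)+1}; the exponents are positive and 0 <
|s| < 1, so taking norms gives k = r. -/
theorem macdonaldBBEigenvalue_column_ne {n r : ℕ} (hr : r ≤ n) {q : ℂ} (hq : q ≠ 0)
    (hq1 : ‖q‖ < 1) {k : ℕ} (hk : k < r) :
    macdonaldBBEigenvalue q q q (column n k) ≠ macdonaldBBEigenvalue q q q (column n r) := by
  set s := q ^ (1 / 2 : ℂ) with hα
  have hs : s ^ 2 = q := by
    rw [hα, one_div]; exact_mod_cast Complex.cpow_nat_inv_pow q two_ne_zero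
  have hs0 : s ≠ 0 := by intro h; rw [h] at hs; simp at hs; exact hq hs.symm
  have hs1 : ‖s‖ < 1 := by
    rw [← hs, norm_pow] at hq1
    exact (pow_lt_one_iff_of_nonneg (norm_nonneg s) two_ne_zero).1 hq1
  intro h
  rw [macdonaldBBEigenvalue_eq hq hs rfl, macdonaldBBEigenvalue_eq hq hs rfl, sub_left_inj] at h
  have hcol := fun {k} (hk : k ≤ n) => shiftEigenvalue_column hk s
  have h1 := (hcol (hk.le.trans hr)).trans (hcol hr).symm
  rw [h, add_right_inj] at h1
  have e : ∀ p ≤ n, (2 * ((n : ℤ) - p) + 1) = ((2 * (n - p) + 1 : ℕ) : ℤ) := by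
    intro p hp; push_cast [hp]; ring
  rw [e k (hk.le.trans hr), e r hr, zpow_neg, zpow_neg, zpow_natCast, zpow_natCast] at h1
  have hlt : ∀ p : ℕ, ‖s ^ (2 * p + 1)‖ < 1 := fun p => by
    rw [norm_pow]; exact pow_lt_one₀ (norm_nonneg s) hs1 (by omega)
  have h2 := add_inv_inj_of_norm_lt_one (pow_ne_zero _ hs0) (pow_ne_zero _ hs0)
    (hlt _) (hlt _) h1
  have h3 := congrArg norm h2
  rw [norm_pow, norm_pow] at h3
  have := pow_right_injective₀ (norm_pos_iff.2 hs0) hs1.ne h3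
  omega

/-! ### The generating function E(x|y) and the Weyl numerators of columns -/

open Polynomial in
theorem genE_eq (n : ℕ) : genE n = ∏ i : Fin n,
    (-(X * C (varL 1 i + varL (-1) i)) + (1 + X ^ 2)) := by
  refine Finset.prod_congr rfl fun i _ => ?_
  have h : (C (varL 1 i) : Polynomial (LaurentPoly n)) * C (varL (-1) i) = 1 := by
    rw [← C_mul, varL_mul_varL, C_1]
  rw [C_add]
  linear_combination X ^ 2 * h

open Polynomial in
/-- The generating function of the Weyl numerators of columns. -/
theorem genE_mul_weylNum (n : ℕ) :
    (1 - X) * genE n * C (weylNum fun _ => 0) =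
      ∑ r : Fin (n + 1), (-1) ^ (r : ℕ) * (X ^ (r : ℕ) - X ^ (2 * n + 1 - r)) *
        C (weylNum (column n r)) := by
  -- The determinant expansion needs y⁻¹, so the identity is proved in the fraction field.
  set φ := algebraMap (Polynomial (LaurentPoly n)) (FractionRing (Polynomial (LaurentPoly n)))
    with hφ
  have hinj : Function.Injective φ := IsFractionRing.injective _ _
  apply hinj
  have hy0 : φ X ≠ 0 := by
    rw [Ne, map_eq_zero_iff _ hinj]; exact X_ne_zero
  have key := altDet_column_expansion (fun i => φ (C (varL 1 i))) (fun i => φ (C (varL (-1) i)))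
    (fun i => by rw [← map_mul, ← C_mul, varL_mul_varL]; simp) (φ X) (φ X)⁻¹
    (mul_inv_cancel₀ hy0)
  have hw : ∀ l : Fin n → ℕ, altDet (fun i => φ (C (varL 1 i))) (fun i => φ (C (varL (-1) i))) l =
      φ (C (altDet (varL 1) (varL (-1)) l)) := fun l =>
    (altDet_map (φ.comp C) (varL 1) (varL (-1)) l).symm
  simp only [hw] at key
  rw [← weylNum_zero] at key
  have hg : φ (genE n) = φ X ^ n * ∏ i : Fin n,
      (φ X + (φ X)⁻¹ - (φ (C (varL 1 i)) + φ (C (varL (-1) i)))) := by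
    have hc : φ X ^ n = ∏ _i : Fin n, φ X := by simp
    rw [genE_eq, map_prod, hc, ← Finset.prod_mul_distrib]
    refine Finset.prod_congr rfl fun i _ => ?_
    simp only [map_add, map_neg, map_mul, map_one, map_pow]
    field_simp
    ring
  rw [map_mul, map_mul, hg, map_sum, map_sub, map_one]
  -- The factor −y^n clears the negative powers of y and turns y − 1 into 1 − y.
  have key' := congrArg (-(φ X) ^ n * ·) key
  simp only [Finset.mul_sum] at key'
  refine Eq.trans ?_ (key'.trans (Finset.sum_congr rfl fun r _ => ?_))
  · ring
  · have hr : (r : ℕ) ≤ n := Nat.lt_succ_iff.1 r.2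
    have h1 : φ X ^ n * (φ X)⁻¹ ^ (n - r : ℕ) = φ X ^ (r : ℕ) := by
      rw [inv_pow, ← div_eq_mul_inv, div_eq_iff (pow_ne_zero _ hy0), ← pow_add]
      congr 1; omega
    have h2 : φ X ^ n * φ X ^ (n - r + 1 : ℕ) = φ X ^ (2 * n + 1 - r : ℕ) := by
      rw [← pow_add]; congr 1; omega
    simp only [map_mul, map_sub, map_pow, map_neg, map_one]
    rw [← h1, ← h2, weylNum]
    ring

theorem polyE_natCast (n r : ℕ) : polyE n r = (-1) ^ r * (genE n).coeff r := by
  simp [polyE]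

open Polynomial in
-- Compare coefficients of y^r in `genE_mul_weylNum`: for r, k ≤ n the exponent 2n + 1 − k exceeds
-- r, so only y^k with k = r contributes.
theorem weylNum_mul_polyE {n r : ℕ} (hr : r ≤ n) :
    (weylNum fun _ => 0) * (polyE n r + polyE n ((r : ℤ) - 1)) = weylNum (column n r) := by
  have h := congrArg (fun p => coeff p r) (genE_mul_weylNum n)
  have hR : coeff (∑ k : Fin (n + 1), (-1) ^ (k : ℕ) * (X ^ (k : ℕ) - X ^ (2 * n + 1 - k)) *
        C (weylNum (column n k))) r = (-1) ^ r * weylNum (column n r) := by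
    have hC : ∀ k : ℕ, ((-1) ^ k : Polynomial (LaurentPoly n)) = C ((-1) ^ k) := fun k => by simp
    rw [finsetSum_coeff, Finset.sum_eq_single ⟨r, by omega⟩]
    · have : r ≠ 2 * n + 1 - r := by omega
      simp [hC, -map_pow, mul_assoc, coeff_C_mul, coeff_mul_C, coeff_X_pow, this]
    · intro k _ hk
      have h1 : r ≠ k := fun h => hk (Fin.ext h.symm)
      have h2 : r ≠ 2 * n + 1 - k := by have := k.2; omega
      simp [hC, -map_pow, mul_assoc, coeff_C_mul, coeff_mul_C, coeff_X_pow, h1, h2]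
    · simp
  rw [hR, coeff_mul_C, sub_mul, one_mul, coeff_sub] at h
  have hsq : ((-1) ^ r * (-1) ^ r : LaurentPoly n) = 1 := by
    rw [← mul_pow]; simp
  obtain _ | r := r
  · rw [polyE_natCast]
    simp [polyE] at h ⊢
    rw [mul_comm, h]
  · rw [polyE_natCast, show ((r + 1 : ℕ) : ℤ) - 1 = (r : ℕ) by push_cast; ring, polyE_natCast]
    rw [coeff_X_mul] at h
    linear_combination (-1) ^ (r + 1) * h + weylNum (column n (r + 1)) * hsq

/-! ### Expansion in monomial symmetric polynomials of columns -/

theorem card_filter_column {n k : ℕ} (hk : k ≤ n) :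
    (Finset.univ.filter fun i : Fin n => (i : ℕ) < k).card = k := by
  rw [Fin.card_filter_val_lt]; omega

theorem mem_orbitW_column {n k : ℕ} (hk : k ≤ n) {μ : Fin n → ℤ} :
    μ ∈ orbitW (column n k) ↔ (∀ i, μ i = 0 ∨ μ i = 1 ∨ μ i = -1) ∧
      (Finset.univ.filter fun i => μ i ≠ 0).card = k := by
  rw [mem_orbitW]
  constructor
  · rintro ⟨w, rfl⟩
    have h0 : ∀ i, signedPerm w (fun i => (column n k i : ℤ)) i ≠ 0 ↔ (w.2 i : ℕ) < k := by
      intro i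
      simp [signedPerm, column]
    refine ⟨fun i => ?_, ?_⟩
    · simp only [signedPerm, column]
      rcases Int.units_eq_one_or (w.1 i) with h | h <;> split_ifs <;> simp [h]
    · simp only [h0]
      refine (Finset.card_equiv w.2 fun i => ?_).trans (card_filter_column hk)
      simp
  · rintro ⟨h1, h2⟩
    -- Any bijection from the support of μ to the first k indices extends to a permutation; the
    -- signs are read off from μ.
    have e : {i // μ i ≠ 0} ≃ {i : Fin n // (i : ℕ) < k} := Fintype.equivOfCardEq (by
      rw [Fintype.card_subtype, Fintype.card_subtype, h2, card_filter_column hk])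
    refine ⟨(fun i => if μ i = -1 then -1 else 1, e.extendSubtype), funext fun i => ?_⟩
    simp only [signedPerm, column]
    by_cases h0 : μ i = 0
    · have := e.extendSubtype_not_mem i (by simpa using h0)
      simp [this, h0]
    · have := e.extendSubtype_mem i h0
      rcases h1 i with h | h | h
      · exact absurd h h0
      · simp [this, h]
      · simp [this, h]

/-- An orbit element is determined by its support t and the subset u of t where it equals 1, which
is how ∏ (x_i + x_i⁻¹) over t expands. -/
theorem monomialSymm_column {n k : ℕ} (hk : k ≤ n) :
    monomialSymm (column n k) =
      ∑ t ∈ Finset.powersetCard k Finset.univ, ∏ i ∈ t, (varL 1 i + varL (-1) i) := by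
  have h1 : ∀ t : Finset (Fin n), ∏ i ∈ t, (varL 1 i + varL (-1) i) =
      ∑ u ∈ t.powerset, monom (fun i => if i ∈ u then 1 else if i ∈ t then -1 else 0) := by
    intro t
    rw [Finset.prod_add]
    refine Finset.sum_congr rfl fun u hu => ?_
    rw [← monom_sum, ← monom_sum, monom_mul]
    congr 1
    ext i
    have hut := Finset.mem_powerset.1 hu
    simp only [Pi.add_apply, Finset.sum_apply, Finset.sum_pi_single, Finset.mem_sdiff]
    by_cases h : i ∈ u
    · simp [h]
    · simp [h]
  simp only [h1]
  rw [Finset.sum_sigma', monomialSymm]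
  refine Finset.sum_bij' (fun μ _ => ⟨Finset.univ.filter fun i => μ i ≠ 0,
    Finset.univ.filter fun i => μ i = 1⟩) (fun p _ => fun i => if i ∈ p.2 then 1 else
      if i ∈ p.1 then -1 else 0) ?_ ?_ ?_ ?_ ?_
  · intro μ hμ
    obtain ⟨-, h2⟩ := (mem_orbitW_column hk).1 hμ
    simp only [Finset.mem_sigma, Finset.mem_powersetCard, Finset.mem_powerset]
    refine ⟨⟨Finset.subset_univ _, h2⟩, fun i hi => ?_⟩
    simp only [Finset.mem_filter, Finset.mem_univ, true_and] at hi ⊢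
    omega
  · rintro ⟨t, u⟩ hp
    simp only [Finset.mem_sigma, Finset.mem_powersetCard, Finset.mem_powerset] at hp
    refine (mem_orbitW_column hk).2 ⟨fun i => ?_, ?_⟩
    · dsimp only; split_ifs <;> simp
    · rw [← hp.1.2]
      congr 1
      ext i
      have := @hp.2 i
      simp only [Finset.mem_filter, Finset.mem_univ, true_and]
      split_ifs <;> simp_all
  · intro μ hμ
    obtain ⟨h1, -⟩ := (mem_orbitW_column hk).1 hμ
    ext i
    rcases h1 i with h | h | h <;> simp [h]
  · rintro ⟨t, u⟩ hp
    simp only [Finset.mem_sigma, Finset.mem_powersetCard, Finset.mem_powerset] at hp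
    simp only [Sigma.mk.injEq, heq_eq_eq]
    constructor
    · ext i
      have := @hp.2 i
      simp only [Finset.mem_filter, Finset.mem_univ, true_and]
      split_ifs <;> simp_all
    · ext i
      simp only [Finset.mem_filter, Finset.mem_univ, true_and]
      split_ifs <;> simp_all
  · intro μ hμ
    obtain ⟨h1, -⟩ := (mem_orbitW_column hk).1 hμ
    congr 1
    ext i
    rcases h1 i with h | h | h <;> simp [h]

open Polynomial in
theorem genE_eq_sum (n : ℕ) : genE n = ∑ k ∈ Finset.range (n + 1),
    X ^ k * (1 + X ^ 2) ^ (n - k) * C ((-1) ^ k * monomialSymm (column n k)) := by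
  rw [genE_eq, Finset.prod_add, Finset.sum_powerset]
  simp only [Finset.card_univ, Fintype.card_fin]
  refine Finset.sum_congr rfl fun k hk => ?_
  rw [monomialSymm_column (by simpa [Nat.lt_succ_iff] using hk), Finset.mul_sum, map_sum,
    Finset.mul_sum]
  refine Finset.sum_congr rfl fun t ht => ?_
  have htk := (Finset.mem_powersetCard.1 ht).2
  have h : ∏ i ∈ t, (-(X * C (varL 1 i + varL (-1) i)) : Polynomial (LaurentPoly n)) =
      X ^ k * C ((-1) ^ k * ∏ i ∈ t, (varL 1 i + varL (-1) i)) := by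
    have h' : ∀ a : LaurentPoly n, -(X * C a) = X * C (-1) * C a := fun a => by simp; ring
    simp only [h', Finset.prod_mul_distrib, Finset.prod_const, htk, C_mul, C_pow, map_prod]
    ring
  rw [h, Finset.prod_const, Finset.card_sdiff_of_subset (Finset.subset_univ t), htk,
    Finset.card_univ, Fintype.card_fin]
  ring

open Polynomial in
theorem coeff_one_add_X_sq_pow (R : Type*) [CommRing R] (m d : ℕ) :
    ((1 + X ^ 2) ^ m : Polynomial R).coeff d = if 2 ∣ d then (m.choose (d / 2) : R) else 0 := by
  have : ((1 + X ^ 2) ^ m : Polynomial R) = expand R 2 ((1 + X) ^ m) := by simp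
  rw [this, coeff_expand two_pos, coeff_one_add_X_pow]

/-- The binomials are coefficients of y^{r−k} in (1 + y²)^{n−k}; only k = r − 2j contributes, and
then (−1)^r (−1)^k = 1. -/
theorem polyE_eq_sum {n r : ℕ} (hr : r ≤ n) : polyE n r = ∑ j ∈ Finset.range (r / 2 + 1),
    ((n - r + 2 * j).choose j : LaurentPoly n) * monomialSymm (column n (r - 2 * j)) := by
  rw [polyE_natCast, genE_eq_sum, Polynomial.finsetSum_coeff, Finset.mul_sum]
  have hterm : ∀ k ∈ Finset.range (n + 1), (-1) ^ r * (Polynomial.X ^ k * (1 + Polynomial.X ^ 2) ^ (n - k) *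
      Polynomial.C ((-1) ^ k * monomialSymm (column n k))).coeff r =
      if k ≤ r ∧ 2 ∣ r - k then
        ((n - k).choose ((r - k) / 2) : LaurentPoly n) * monomialSymm (column n k) else 0 := by
    intro k _
    rw [Polynomial.coeff_mul_C, Polynomial.coeff_X_pow_mul', coeff_one_add_X_sq_pow]
    by_cases h1 : k ≤ r
    · by_cases h2 : 2 ∣ r - k
      · rw [if_pos h1, if_pos h2, if_pos ⟨h1, h2⟩]
        obtain ⟨j, hj⟩ := h2
        have hs : ((-1) ^ r * (-1) ^ k : LaurentPoly n) = 1 := by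
          rw [← pow_add, show r + k = 2 * (j + k) by omega, pow_mul]; simp
        linear_combination ((n - k).choose ((r - k) / 2) : LaurentPoly n) *
          monomialSymm (column n k) * hs
      · rw [if_pos h1, if_neg h2, if_neg (fun h => h2 h.2)]; simp
    · rw [if_neg h1, if_neg (fun h => h1 h.1)]; simp
  rw [Finset.sum_congr rfl hterm, ← Finset.sum_filter]
  refine Finset.sum_bij' (fun k _ => (r - k) / 2) (fun j _ => r - 2 * j) ?_ ?_ ?_ ?_ ?_
  · intro k hk
    simp only [Finset.mem_filter, Finset.mem_range] at hk ⊢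
    omega
  · intro j hj
    simp only [Finset.mem_filter, Finset.mem_range] at hj ⊢
    omega
  · intro k hk
    simp only [Finset.mem_filter, Finset.mem_range] at hk ⊢
    omega
  · intro j hj
    simp only [Finset.mem_range] at hj ⊢
    omega
  · intro k hk
    simp only [Finset.mem_filter, Finset.mem_range] at hk ⊢
    have h1 : n - r + 2 * ((r - k) / 2) = n - k := by omega
    have h2 : r - 2 * ((r - k) / 2) = k := by omega
    rw [h1, h2]

/-- `(r + 1) / 2` counts the j with 2j + 1 ≤ r, so the sum is empty at r = 0, in agreement with
E_{-1} = 0. -/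
theorem polyE_pred_eq_sum {n r : ℕ} (hr : r ≤ n) : polyE n ((r : ℤ) - 1) =
    ∑ j ∈ Finset.range ((r + 1) / 2), ((n - r + 2 * j + 1).choose j : LaurentPoly n) *
      monomialSymm (column n (r - 2 * j - 1)) := by
  obtain _ | r := r
  · simp [polyE]
  · rw [show ((r + 1 : ℕ) : ℤ) - 1 = (r : ℕ) by push_cast; ring, polyE_eq_sum (by omega),
      show (r + 1 + 1) / 2 = r / 2 + 1 by omega]
    refine Finset.sum_congr rfl fun j _ => ?_
    rw [show n - (r + 1) + 2 * j + 1 = n - r + 2 * j by omega,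
      show r + 1 - 2 * j - 1 = r - 2 * j by omega]
-- The two parts of the theorem
theorem mainTheorem12 (n : ℕ) (q : ℂ) (hq0 : q ≠ 0) (hq1 : ‖q‖ < 1) :
    (∀ lam : Fin n → ℕ, IsPartition lam →
      ∃ S : LaurentPoly n,
        schurB lam = algebraMap (LaurentPoly n) (RatFun n) S ∧
        IsMacdonaldBB q q q lam S ∧
        ((∀ mu : Fin n → ℕ, IsPartition mu → DomLT mu lam →
            macdonaldBBEigenvalue q q q mu ≠ macdonaldBBEigenvalue q q q lam) →
          (∃! P : LaurentPoly n, IsMacdonaldBB q q q lam P) ∧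
          schurB lam = algebraMap (LaurentPoly n) (RatFun n) (macdonaldBB q q q lam))) ∧
    ∀ r : ℕ, r ≤ n →
      (∃! P : LaurentPoly n, IsMacdonaldBB q q q (column n r) P) ∧
      schurB (column n r) =
        algebraMap (LaurentPoly n) (RatFun n) (macdonaldBB q q q (column n r)) ∧
      macdonaldBB q q q (column n r) = polyE n r + polyE n ((r : ℤ) - 1) ∧
      polyE n r + polyE n ((r : ℤ) - 1) =
        ∑ j ∈ Finset.range (r / 2 + 1),
            ((n - r + 2 * j).choose j : LaurentPoly n) * monomialSymm (column n (r - 2 * j)) +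
          ∑ j ∈ Finset.range ((r + 1) / 2),
            ((n - r + 2 * j + 1).choose j : LaurentPoly n) *
              monomialSymm (column n (r - 2 * j - 1)) := by
  have hs : (q ^ (1 / 2 : ℂ)) ^ 2 = q := by
    rw [one_div]; exact_mod_cast Complex.cpow_nat_inv_pow q two_ne_zero
  refine ⟨fun lam hlam => ?_, fun r hr => ?_⟩
  · obtain ⟨S, hS, hS'⟩ := exists_weylNum_mul_eq lam hlam
    have hM := isMacdonaldBB_of_weylNum_mul_eq hq0 hs rfl hS hS'
    refine ⟨S, schurB_eq hS, hM, fun hne => ?_⟩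
    have hu : ∀ P, IsMacdonaldBB q q q lam P → P = S :=
      fun P hP => isMacdonaldBB_unique hq0 hs rfl hne hP hM
    exact ⟨⟨S, hM, hu⟩, by rw [macdonaldBB_eq hM hu]; exact schurB_eq hS⟩
  · obtain ⟨S, hS, hS'⟩ := exists_weylNum_mul_eq _ (column_isPartition n r)
    have hM := isMacdonaldBB_of_weylNum_mul_eq hq0 hs rfl hS hS'
    have hu : ∀ P, IsMacdonaldBB q q q (column n r) P → P = S := by
      refine fun P hP => isMacdonaldBB_unique hq0 hs rfl (fun mu hmu hlt => ?_) hP hM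
      obtain ⟨k, hk, rfl⟩ := eq_column_of_domLT hr hmu hlt
      exact macdonaldBBEigenvalue_column_ne hr hq0 hq1 hk
    -- Both sides have product N_{(1^r)} with Δ, and Δ ≠ 0 cancels.
    have hSE : S = polyE n r + polyE n ((r : ℤ) - 1) :=
      mul_left_cancel₀ (weylNum_zero_ne_zero n) (hS.trans (weylNum_mul_polyE hr).symm)
    refine ⟨⟨S, hM, hu⟩, ?_, ?_, ?_⟩
    · rw [macdonaldBB_eq hM hu]; exact schurB_eq hS
    · rw [macdonaldBB_eq hM hu, hSE]
    · rw [polyE_eq_sum hr, polyE_pred_eq_sum hr]
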